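/- All tensor products $\otimes$ of C*-algebras are spatial (minimal), $\iota$ is the identity map and $I$ the unit. A compact quantum group $G=(\mathcal A,\Delta)$ is a unital C*-algebra $\mathcal A$ with a unital $*$-homomorphism $\Delta:\mathcal A\to\mathcal A\otimes\mathcal A$ such that $(\Delta\otimes\iota)\Delta=(\iota\otimes\Delta)\Delta$ and both $(\mathcal A\otimes I)\Delta(\mathcal A)$ and $(I\otimes\mathcal A)\Delta(\mathcal A)$ span dense subspaces of $\mathcal A\otimes\mathcal A$; its Haar state $h$ is the state with $(h\otimes\iota)\Delta(a)=h(a)I=(\iota\otimes h)\Delta(a)$. An action of $G$ on a unital C*-algebra $\mathcal C$ is a unital $*$-homomorphism $\delta:\mathcal C\to\mathcal C\otimes\mathcal A$ with $(\delta\otimes\iota)\delta=(\iota\otimes\Delta)\delta$. A compact quantum subgroup of $G$ is a pair $K=(\mathcal A',\Delta')$ of a unital C*-algebra (possibly zero) and a unital $*$-homomorphism $\Delta':\mathcal A'\to\mathcal A'\otimes\mathcal A'$, together with a surjective unital $*$-homomorphism $\pi:\mathcal A\to\mathcal A'$ such that $(\pi\otimes\pi)\Delta=\Delta'\pi$; the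 quantum quotient space $K\backslash G$ is the C*-algebra $\mathcal A^{K}=\{T\in\mathcal A:(\pi\otimes\iota)\Delta(T)=I\otimes T\}$ with the action $\eta':\mathcal A^K\to\mathcal A^K\otimes\mathcal A$ of $G$ obtained by restricting $\Delta$. **Theorem.** Let $\delta:\mathcal C\to\mathcal C\otimes\mathcal A$ be an action of the compact quantum group $G=(\mathcal A,\Delta)$ on a unital C*-algebra $\mathcal C$, and let $\chi:\mathcal C\to\mathbb C$ be a (unital) $*$-character. Assume that (a) the linear span of $(I\otimes\mathcal A)\,\delta(\mathcal C)$ is norm dense in $\mathcal C\otimes\mathcal A$; (b) $\delta$ is ergodic: $\{c\in\mathcal C:\delta(c)=c\otimes I\}=\mathbb C I$; (c) $\delta$ is injective, and the Haar state $h$ of $G$ is faithful, i.e. $h(a^*a)=0$ implies $a=0$. Put $T_\chi=(\chi\otimes\iota)\circ\delta:\mathcal C\to\mathcal A$ and let $J_\chi$ be the closed two-sided ideal of $\mathcal A$ generated by $\{T_\chi(c)-\chi(c)I:c\in\mathcal C\}$. Then there is a compact quantum subgroup $G_\chi$ of $G$ (the subgroup stabilizing $\chi$) whose quotient map $\pi$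 has kernel $J_\chi$. For every such $G_\chi$, the restriction of $\Delta$ defines an action $\eta'$ of $G$ on $\mathcal A^{G_\chi}$, the map $T_\chi$ takes its values in $\mathcal A^{G_\chi}$, it is $G$-equivariant, $\eta'\circ T_\chi=(T_\chi\otimes\iota)\circ\delta$, and $T_\chi:\mathcal C\to\mathcal A^{G_\chi}$ is injective. Thus $\mathcal C$ embeds $G$-equivariantly into the quantum quotient space $G_\chi\backslash G$. -/

import Mathlib

open scoped TensorProduct ComplexOrder InnerProductSpace

universe u

noncomputable section

namespace CQG

/-- A unital `*`-representation of a unital C*-algebra on a Hilbert space. -/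
structure Rep (A : Type u) [CStarAlgebra A] : Type (u + 1) where
  H : Type u
  [ng : NormedAddCommGroup H]
  [ip : InnerProductSpace ℂ H]
  [cs : CompleteSpace H]
  π : A →⋆ₐ[ℂ] (H →L[ℂ] H)

attribute [instance] Rep.ng Rep.ip Rep.cs

/-- The Hilbert space tensor product: the completion of the algebraic tensor product. -/
def HilbertTensor (H K : Type u) [NormedAddCommGroup H] [InnerProductSpace ℂ H]
    [NormedAddCommGroup K] [InnerProductSpace ℂ K] : Type u :=
  UniformSpace.Completion (H ⊗[ℂ] K)

section Hilbert

open UniformSpace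

variable {H K : Type u} [NormedAddCommGroup H] [InnerProductSpace ℂ H]
  [NormedAddCommGroup K] [InnerProductSpace ℂ K]

instance : NormedAddCommGroup (HilbertTensor H K) :=
  inferInstanceAs (NormedAddCommGroup (Completion (H ⊗[ℂ] K)))

instance : InnerProductSpace ℂ (HilbertTensor H K) :=
  inferInstanceAs (InnerProductSpace ℂ (Completion (H ⊗[ℂ] K)))

instance : CompleteSpace (HilbertTensor H K) :=
  inferInstanceAs (CompleteSpace (Completion (H ⊗[ℂ] K)))

/-- The canonical isometric inclusion of the algebraic tensor product. -/
def HilbertTensor.of : (H ⊗[ℂ] K) →ₗᵢ[ℂ] HilbertTensor H K :=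
  Completion.toComplₗᵢ (𝕜 := ℂ) (E := H ⊗[ℂ] K)

theorem HilbertTensor.induction {p : HilbertTensor H K → Prop} (x : HilbertTensor H K)
    (hc : IsClosed {x | p x}) (h : ∀ v : H ⊗[ℂ] K, p (HilbertTensor.of v)) : p x :=
  Completion.induction_on x hc h

/-- The bounded operator `S ⊗ T` on the Hilbert space tensor product. -/
def opTensor (S : H →L[ℂ] H) (T : K →L[ℂ] K) : HilbertTensor H K →L[ℂ] HilbertTensor H K :=
  (TensorProduct.mapL S T).completion

theorem opTensor_of (S : H →L[ℂ] H) (T : K →L[ℂ] K) (v : H ⊗[ℂ] K) :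
    opTensor S T (HilbertTensor.of v) = HilbertTensor.of (TensorProduct.mapL S T v) :=
  ContinuousLinearMap.completion_apply_coe _ _

theorem opTensor_ext {S T : HilbertTensor H K →L[ℂ] HilbertTensor H K}
    (h : ∀ v : H ⊗[ℂ] K, S (HilbertTensor.of v) = T (HilbertTensor.of v)) : S = T := by
  ext x
  exact HilbertTensor.induction x (p := fun x => S x = T x)
    (isClosed_eq S.continuous T.continuous) h

theorem opTensor_mul (S S' : H →L[ℂ] H) (T T' : K →L[ℂ] K) :
    opTensor (S * S') (T * T') = opTensor S T * opTensor S' T' := by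
  apply opTensor_ext
  intro v
  rw [mul_apply_eq_comp, opTensor_of, opTensor_of, opTensor_of, TensorProduct.mapL_mul]
  rfl

theorem opTensor_one : opTensor (1 : H →L[ℂ] H) (1 : K →L[ℂ] K) = 1 := by
  apply opTensor_ext
  intro v
  rw [opTensor_of]
  have : TensorProduct.mapL (1 : H →L[ℂ] H) (1 : K →L[ℂ] K) = ContinuousLinearMap.id ℂ _ :=
    TensorProduct.mapL_id_id
  rw [this]; rfl

theorem inner_mapL [CompleteSpace H] [CompleteSpace K] (S : H →L[ℂ] H) (T : K →L[ℂ] K)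
    (v w : H ⊗[ℂ] K) :
    ⟪TensorProduct.mapL (star S) (star T) v, w⟫_ℂ = ⟪v, TensorProduct.mapL S T w⟫_ℂ := by
  induction v with
  | zero => simp
  | add x y hx hy => rw [map_add, inner_add_left, inner_add_left, hx, hy]
  | tmul x y =>
    induction w with
    | zero => simp
    | add x y hx hy => rw [map_add, inner_add_right, inner_add_right, hx, hy]
    | tmul x' y' =>
      simp [ContinuousLinearMap.star_eq_adjoint, ContinuousLinearMap.adjoint_inner_left]

theorem opTensor_star [CompleteSpace H] [CompleteSpace K] (S : H →L[ℂ] H) (T : K →L[ℂ] K) :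
    opTensor (star S) (star T) = star (opTensor S T) := by
  rw [ContinuousLinearMap.star_eq_adjoint (opTensor S T)]
  refine (ContinuousLinearMap.eq_adjoint_iff _ _).mpr fun x y => ?_
  refine HilbertTensor.induction x
    (p := fun x => ⟪opTensor (star S) (star T) x, y⟫_ℂ = ⟪x, opTensor S T y⟫_ℂ)
    (isClosed_eq (by fun_prop) (by fun_prop)) fun v => ?_
  refine HilbertTensor.induction y
    (p := fun y => ⟪opTensor (star S) (star T) (HilbertTensor.of v), y⟫_ℂ =
      ⟪HilbertTensor.of v, opTensor S T y⟫_ℂ)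
    (isClosed_eq (by fun_prop) (by fun_prop)) fun w => ?_
  rw [opTensor_of, opTensor_of, LinearIsometry.inner_map_map, LinearIsometry.inner_map_map,
    inner_mapL]

theorem norm_opTensor_le (S : H →L[ℂ] H) (T : K →L[ℂ] K) :
    ‖opTensor S T‖ ≤ ‖S‖ * ‖T‖ := by
  refine ContinuousLinearMap.opNorm_le_bound _ (by positivity) fun x => ?_
  refine HilbertTensor.induction x (p := fun x => ‖opTensor S T x‖ ≤ ‖S‖ * ‖T‖ * ‖x‖)
    (isClosed_le (by fun_prop) (by fun_prop)) fun v => ?_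
  rw [opTensor_of, LinearIsometry.norm_map, LinearIsometry.norm_map]
  exact ((TensorProduct.mapL S T).le_opNorm v).trans
    (mul_le_mul_of_nonneg_right (TensorProduct.norm_mapL_le S T) (norm_nonneg _))

theorem opTensor_add_left (S S' : H →L[ℂ] H) (T : K →L[ℂ] K) :
    opTensor (S + S') T = opTensor S T + opTensor S' T := by
  apply opTensor_ext
  intro v
  simp only [add_apply, opTensor_of, TensorProduct.mapL_add_left, map_add]

theorem opTensor_add_right (S : H →L[ℂ] H) (T T' : K →L[ℂ] K) :
    opTensor S (T + T') = opTensor S T + opTensor S T' := by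
  apply opTensor_ext
  intro v
  simp only [add_apply, opTensor_of, TensorProduct.mapL_add_right, map_add]

theorem opTensor_smul_left (c : ℂ) (S : H →L[ℂ] H) (T : K →L[ℂ] K) :
    opTensor (c • S) T = c • opTensor S T := by
  apply opTensor_ext
  intro v
  simp only [smul_apply, opTensor_of, TensorProduct.mapL_smul_left, map_smul]

theorem opTensor_smul_right (c : ℂ) (S : H →L[ℂ] H) (T : K →L[ℂ] K) :
    opTensor S (c • T) = c • opTensor S T := by
  apply opTensor_ext
  intro v
  simp only [smul_apply, opTensor_of, TensorProduct.mapL_smul_right, map_smul]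

end Hilbert

variable {A B : Type u} [CStarAlgebra A] [CStarAlgebra B]

/-- The representation `ρ ⊗ σ` of the algebraic tensor product on the Hilbert space tensor
product, `a ⊗ b ↦ ρ(a) ⊗ σ(b)`. -/
def algRep (ρ : Rep A) (σ : Rep B) :
    A ⊗[ℂ] B →ₐ[ℂ] (HilbertTensor ρ.H σ.H →L[ℂ] HilbertTensor ρ.H σ.H) :=
  Algebra.TensorProduct.algHomOfLinearMapTensorProduct
    (TensorProduct.lift (LinearMap.mk₂ ℂ (fun a b => opTensor (ρ.π a) (σ.π b))
      (fun a a' b => by rw [map_add, opTensor_add_left])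
      (fun c a b => by rw [map_smul, opTensor_smul_left])
      (fun a b b' => by rw [map_add, opTensor_add_right])
      (fun c a b => by rw [map_smul, opTensor_smul_right])))
    (fun a a' b b' => by simp [opTensor_mul])
    (by simp [opTensor_one])

theorem algRep_tmul (ρ : Rep A) (σ : Rep B) (a : A) (b : B) :
    algRep ρ σ (a ⊗ₜ b) = opTensor (ρ.π a) (σ.π b) := rfl

theorem algRep_star (ρ : Rep A) (σ : Rep B) (x : A ⊗[ℂ] B) :
    algRep ρ σ (star x) = star (algRep ρ σ x) := by
  induction x with
  | zero => simp
  | add x y hx hy => simp [hx, hy]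
  | tmul a b => rw [TensorProduct.star_tmul, algRep_tmul, algRep_tmul, map_star, map_star,
      opTensor_star]

theorem Rep.norm_le (ρ : Rep A) (a : A) : ‖ρ.π a‖ ≤ ‖a‖ :=
  NonUnitalStarAlgHom.norm_apply_le ρ.π a

/-- The spatial (minimal) C*-norm on the algebraic tensor product: the supremum of the operator
norms of `(ρ ⊗ σ)(x)` over all pairs of representations. -/
def spatialNorm (x : A ⊗[ℂ] B) : ℝ := ⨆ p : Rep A × Rep B, ‖algRep p.1 p.2 x‖

theorem spatialNorm_bdd (x : A ⊗[ℂ] B) :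
    BddAbove (Set.range fun p : Rep A × Rep B => ‖algRep p.1 p.2 x‖) := by
  induction x with
  | zero => exact ⟨0, by rintro _ ⟨p, rfl⟩; simp⟩
  | add x y hx hy =>
    obtain ⟨M, hM⟩ := hx
    obtain ⟨N, hN⟩ := hy
    refine ⟨M + N, ?_⟩
    rintro _ ⟨p, rfl⟩
    simp only [map_add]
    exact (norm_add_le _ _).trans (add_le_add (hM ⟨p, rfl⟩) (hN ⟨p, rfl⟩))
  | tmul a b =>
    refine ⟨‖a‖ * ‖b‖, ?_⟩
    rintro _ ⟨p, rfl⟩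
    simp only [algRep_tmul]
    exact (norm_opTensor_le _ _).trans
      (mul_le_mul (p.1.norm_le a) (p.2.norm_le b) (norm_nonneg _) (norm_nonneg _))

theorem le_spatialNorm (ρ : Rep A) (σ : Rep B) (x : A ⊗[ℂ] B) :
    ‖algRep ρ σ x‖ ≤ spatialNorm x :=
  le_ciSup (spatialNorm_bdd x) (ρ, σ)

/-- The zero representation space. -/
def Rep.triv (A : Type u) [CStarAlgebra A] : Rep A where
  H := PUnit
  π := { toFun := fun _ => 0, map_one' := Subsingleton.elim _ _, map_mul' := by simp,
         map_zero' := rfl, map_add' := by simp, commutes' := fun _ => Subsingleton.elim _ _,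
         map_star' := by simp }

instance : Nonempty (Rep A × Rep B) := ⟨(Rep.triv A, Rep.triv B)⟩

theorem spatialNorm_le {x : A ⊗[ℂ] B} {M : ℝ}
    (h : ∀ (ρ : Rep A) (σ : Rep B), ‖algRep ρ σ x‖ ≤ M) : spatialNorm x ≤ M :=
  ciSup_le fun p => h p.1 p.2

theorem spatialNorm_nonneg (x : A ⊗[ℂ] B) : 0 ≤ spatialNorm x :=
  (norm_nonneg _).trans (le_spatialNorm (Rep.triv A) (Rep.triv B) x)

/-- The algebraic tensor product, equipped below with the spatial C*-norm. -/
def AlgTensor (A B : Type u) [CStarAlgebra A] [CStarAlgebra B] : Type u := A ⊗[ℂ] B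

namespace AlgTensor

instance : Ring (AlgTensor A B) := inferInstanceAs (Ring (A ⊗[ℂ] B))
instance : Algebra ℂ (AlgTensor A B) := inferInstanceAs (Algebra ℂ (A ⊗[ℂ] B))
instance : StarRing (AlgTensor A B) := inferInstanceAs (StarRing (A ⊗[ℂ] B))
instance : StarModule ℂ (AlgTensor A B) := inferInstanceAs (StarModule ℂ (A ⊗[ℂ] B))

instance : SeminormedRing (AlgTensor A B) :=
  RingSeminorm.toSeminormedRing
    { toFun := fun x => spatialNorm (A := A) (B := B) x
      map_zero' := le_antisymm (spatialNorm_le fun ρ σ => (congrArg norm (map_zero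
          (algRep ρ σ))).trans norm_zero |>.le) (spatialNorm_nonneg _)
      add_le' := fun x y => spatialNorm_le fun ρ σ =>
        (congrArg norm (map_add (algRep ρ σ) x y)).le.trans <| (norm_add_le _ _).trans
          (add_le_add (le_spatialNorm _ _ _) (le_spatialNorm _ _ _))
      neg' := fun x => congrArg iSup (funext fun p =>
        (congrArg norm (map_neg (algRep p.1 p.2) x)).trans (norm_neg _))
      mul_le' := fun x y => spatialNorm_le fun ρ σ =>
        (congrArg norm (map_mul (algRep ρ σ) x y)).le.trans <| (norm_mul_le _ _).trans
          (mul_le_mul (le_spatialNorm _ _ _) (le_spatialNorm _ _ _) (norm_nonneg _)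
            (spatialNorm_nonneg _)) }

theorem norm_def (x : AlgTensor A B) : ‖x‖ = spatialNorm (A := A) (B := B) x := rfl

instance : NormedAlgebra ℂ (AlgTensor A B) where
  norm_smul_le c x := spatialNorm_le fun ρ σ =>
    (congrArg norm (map_smul (algRep ρ σ) c x)).le.trans <| (norm_smul_le _ _).trans
      (mul_le_mul_of_nonneg_left (le_spatialNorm _ _ _) (norm_nonneg _))

theorem norm_star (x : AlgTensor A B) : ‖star x‖ = ‖x‖ :=
  congrArg iSup (funext fun p => (congrArg norm (algRep_star p.1 p.2 x)).trans
    (_root_.norm_star _))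

theorem norm_mul_self_le (x : AlgTensor A B) : ‖x‖ * ‖x‖ ≤ ‖star x * x‖ := by
  have h : ‖x‖ ≤ Real.sqrt ‖star x * x‖ := spatialNorm_le fun ρ σ => by
    apply Real.le_sqrt_of_sq_le
    have h1 : ∀ y : A ⊗[ℂ] B, ‖algRep ρ σ y‖ ^ 2 ≤ spatialNorm (star y * y) := fun y => by
      rw [sq, ← CStarRing.norm_star_mul_self, ← algRep_star, ← map_mul]
      exact le_spatialNorm ρ σ _
    exact h1 x
  calc ‖x‖ * ‖x‖ ≤ Real.sqrt ‖star x * x‖ * Real.sqrt ‖star x * x‖ :=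
        mul_le_mul h h (norm_nonneg _) (Real.sqrt_nonneg _)
    _ = _ := Real.mul_self_sqrt (norm_nonneg _)

end AlgTensor

/-- The spatial tensor product of two unital C*-algebras: the completion of the algebraic tensor
product in the spatial norm. -/
def SpatialTensor (A B : Type u) [CStarAlgebra A] [CStarAlgebra B] : Type u :=
  UniformSpace.Completion (AlgTensor A B)

namespace SpatialTensor

open UniformSpace

instance : NormedRing (SpatialTensor A B) :=
  inferInstanceAs (NormedRing (Completion (AlgTensor A B)))

instance : CompleteSpace (SpatialTensor A B) :=
  inferInstanceAs (CompleteSpace (Completion (AlgTensor A B)))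

instance : Algebra ℂ (SpatialTensor A B) :=
  inferInstanceAs (Algebra ℂ (Completion (AlgTensor A B)))

/-- The canonical map from the algebraic tensor product. -/
def ofAlg (x : AlgTensor A B) : SpatialTensor A B := (x : Completion (AlgTensor A B))

theorem norm_ofAlg (x : AlgTensor A B) : ‖ofAlg x‖ = ‖x‖ := Completion.norm_coe x

theorem ofAlg_add (x y : AlgTensor A B) : ofAlg (x + y) = ofAlg x + ofAlg y :=
  Completion.coe_add x y

theorem ofAlg_mul (x y : AlgTensor A B) : ofAlg (x * y) = ofAlg x * ofAlg y :=
  Completion.coe_mul x y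

theorem ofAlg_one : ofAlg (1 : AlgTensor A B) = 1 := rfl

theorem ofAlg_zero : ofAlg (0 : AlgTensor A B) = 0 := rfl

theorem ofAlg_smul (c : ℂ) (x : AlgTensor A B) : ofAlg (c • x) = c • ofAlg x :=
  Completion.coe_smul c x

@[fun_prop]
theorem continuous_ofAlg : Continuous (ofAlg : AlgTensor A B → SpatialTensor A B) :=
  Completion.continuous_coe _

theorem denseRange_ofAlg : DenseRange (ofAlg : AlgTensor A B → SpatialTensor A B) :=
  Completion.denseRange_coe

theorem isUniformInducing_ofAlg :
    IsUniformInducing (ofAlg : AlgTensor A B → SpatialTensor A B) :=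
  Completion.isUniformInducing_coe _

theorem induction {p : SpatialTensor A B → Prop} (x : SpatialTensor A B)
    (hc : IsClosed {x | p x}) (h : ∀ x : AlgTensor A B, p (ofAlg x)) : p x :=
  Completion.induction_on x hc h

theorem induction₂ {p : SpatialTensor A B → SpatialTensor A B → Prop} (x y : SpatialTensor A B)
    (hc : IsClosed {x : SpatialTensor A B × SpatialTensor A B | p x.1 x.2})
    (h : ∀ x y : AlgTensor A B, p (ofAlg x) (ofAlg y)) : p x y :=
  Completion.induction_on₂ x y hc h

instance : NormedAlgebra ℂ (SpatialTensor A B) where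
  norm_smul_le c x := by
    refine induction x (p := fun x => ‖c • x‖ ≤ ‖c‖ * ‖x‖) (isClosed_le ?_ ?_) fun x => ?_
    · exact (uniformContinuous_const_smul (X := Completion (AlgTensor A B)) c).continuous.norm
    · fun_prop
    · rw [← ofAlg_smul, norm_ofAlg, norm_ofAlg]
      exact norm_smul_le c x

theorem isometry_star_alg : Isometry (star : AlgTensor A B → AlgTensor A B) :=
  AddMonoidHomClass.isometry_of_norm (starAddEquiv (R := AlgTensor A B)) AlgTensor.norm_star

instance : Star (SpatialTensor A B) where
  star := Completion.map (star : AlgTensor A B → AlgTensor A B)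

theorem star_ofAlg (x : AlgTensor A B) : star (ofAlg x) = ofAlg (star x) :=
  Completion.map_coe isometry_star_alg.uniformContinuous x

theorem continuous_star' : Continuous (star : SpatialTensor A B → SpatialTensor A B) :=
  Completion.continuous_map

instance : ContinuousStar (SpatialTensor A B) := ⟨continuous_star'⟩

instance : StarRing (SpatialTensor A B) where
  star_involutive x := by
    refine induction x (p := fun x => star (star x) = x)
      (isClosed_eq (by fun_prop) (by fun_prop)) fun x => ?_
    rw [star_ofAlg, star_ofAlg, star_star]
  star_mul x y := by
    refine induction₂ x y (p := fun x y => star (x * y) = star y * star x)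
      (isClosed_eq (by fun_prop) (by fun_prop)) fun x y => ?_
    simp only [star_ofAlg, ← ofAlg_mul, star_mul]
  star_add x y := by
    refine induction₂ x y (p := fun x y => star (x + y) = star x + star y)
      (isClosed_eq (by fun_prop) (by fun_prop)) fun x y => ?_
    simp only [star_ofAlg, ← ofAlg_add, star_add]

instance : CStarRing (SpatialTensor A B) where
  norm_mul_self_le x := by
    refine induction x (p := fun x => ‖x‖ * ‖x‖ ≤ ‖star x * x‖) (isClosed_le (by fun_prop)
      (by fun_prop)) fun x => ?_
    rw [star_ofAlg, ← ofAlg_mul, norm_ofAlg, norm_ofAlg]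
    exact AlgTensor.norm_mul_self_le x

theorem star_smul' (c : ℂ) (x : SpatialTensor A B) : star (c • x) = star c • star x := by
  have h1 : Continuous fun x : SpatialTensor A B => star (c • x) :=
    continuous_star'.comp (continuous_const_smul c)
  have h2 : Continuous fun x : SpatialTensor A B => star c • star x :=
    (continuous_const_smul (star c)).comp continuous_star'
  refine induction x (p := fun x => star (c • x) = star c • star x)
    (isClosed_eq h1 h2) fun x => ?_
  rw [← ofAlg_smul, star_ofAlg, star_ofAlg, ← ofAlg_smul, star_smul]

instance : StarModule ℂ (SpatialTensor A B) := ⟨star_smul'⟩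

instance : CStarAlgebra (SpatialTensor A B) where

end SpatialTensor
end CQG

namespace CQG

namespace SpatialTensor

open UniformSpace

variable {A B A' B' E : Type u} [CStarAlgebra A] [CStarAlgebra B] [CStarAlgebra A']
  [CStarAlgebra B'] [CStarAlgebra E]

/-- The elementary tensor `a ⊗ b` in the spatial tensor product. -/
def tmul (a : A) (b : B) : SpatialTensor A B :=
  ofAlg (show AlgTensor A B from (a ⊗ₜ[ℂ] b : A ⊗[ℂ] B))

theorem tmul_mul_tmul (a a' : A) (b b' : B) :
    tmul a b * tmul a' b' = tmul (a * a') (b * b') := by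
  rw [tmul, tmul, ← ofAlg_mul]
  exact congrArg ofAlg (Algebra.TensorProduct.tmul_mul_tmul a a' b b')

theorem star_tmul (a : A) (b : B) : star (tmul a b) = tmul (star a) (star b) := by
  rw [tmul, star_ofAlg]
  rfl

theorem one_eq_tmul : (1 : SpatialTensor A B) = tmul 1 1 := rfl

theorem add_tmul (a a' : A) (b : B) : tmul (a + a') b = tmul a b + tmul a' b := by
  rw [tmul, tmul, tmul, ← ofAlg_add]
  exact congrArg ofAlg (TensorProduct.add_tmul a a' b)

theorem tmul_add (a : A) (b b' : B) : tmul a (b + b') = tmul a b + tmul a b' := by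
  rw [tmul, tmul, tmul, ← ofAlg_add]
  exact congrArg ofAlg (TensorProduct.tmul_add a b b')

theorem smul_tmul (c : ℂ) (a : A) (b : B) : tmul (c • a) b = c • tmul a b := by
  rw [tmul, tmul, ← ofAlg_smul]
  exact congrArg ofAlg (TensorProduct.smul_tmul' c a b).symm

theorem tmul_smul (c : ℂ) (a : A) (b : B) : tmul a (c • b) = c • tmul a b := by
  rw [tmul, tmul, ← ofAlg_smul]
  exact congrArg ofAlg (TensorProduct.tmul_smul c a b)

theorem norm_tmul_le (a : A) (b : B) : ‖tmul a b‖ ≤ ‖a‖ * ‖b‖ := by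
  rw [tmul, norm_ofAlg]
  refine spatialNorm_le fun ρ σ => ?_
  rw [algRep_tmul]
  exact (norm_opTensor_le _ _).trans
      (mul_le_mul (ρ.norm_le a) (σ.norm_le b) (norm_nonneg _) (norm_nonneg _))

/-- To prove a closed, additive property it suffices to check elementary tensors. -/
theorem induction_tmul {p : SpatialTensor A B → Prop} (x : SpatialTensor A B)
    (hc : IsClosed {x | p x}) (h0 : p 0) (hadd : ∀ x y, p x → p y → p (x + y))
    (h : ∀ (a : A) (b : B), p (tmul a b)) : p x := by
  refine induction x hc fun y => ?_
  refine TensorProduct.induction_on (motive := fun y : A ⊗[ℂ] B => p (ofAlg y)) y h0 h ?_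
  intro x y hx hy
  exact (congrArg p (ofAlg_add (A := A) (B := B) x y)).mpr (hadd _ _ hx hy)

/-- Extension of a bounded linear map from the algebraic to the spatial tensor product. -/
def extendL {F : Type*} [NormedAddCommGroup F] [NormedSpace ℂ F] [CompleteSpace F]
    (T : A ⊗[ℂ] B →ₗ[ℂ] F) (M : ℝ) (hT : ∀ x, ‖T x‖ ≤ M * spatialNorm x) :
    SpatialTensor A B →L[ℂ] F :=
  (LinearMap.mkContinuous (show AlgTensor A B →ₗ[ℂ] F from T) M hT).fromCompletion

theorem extendL_ofAlg {F : Type*} [NormedAddCommGroup F] [NormedSpace ℂ F] [CompleteSpace F]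
    (T : A ⊗[ℂ] B →ₗ[ℂ] F) (M : ℝ) (hT : ∀ x, ‖T x‖ ≤ M * spatialNorm x) (x : AlgTensor A B) :
    extendL T M hT (ofAlg x) = T x :=
  ContinuousLinearMap.fromCompletion_apply_coe _ _

theorem extendL_tmul {F : Type*} [NormedAddCommGroup F] [NormedSpace ℂ F] [CompleteSpace F]
    (T : A ⊗[ℂ] B →ₗ[ℂ] F) (M : ℝ) (hT : ∀ x, ‖T x‖ ≤ M * spatialNorm x) (a : A) (b : B) :
    extendL T M hT (tmul a b) = T (a ⊗ₜ b) :=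
  extendL_ofAlg T M hT _

/-- Extension of a contractive `*`-homomorphism to the spatial tensor product. -/
def extendHom (T : A ⊗[ℂ] B →ₐ[ℂ] E) (hs : ∀ x, T (star x) = star (T x))
    (hT : ∀ x, ‖T x‖ ≤ spatialNorm x) : SpatialTensor A B →⋆ₐ[ℂ] E :=
  let F := extendL T.toLinearMap 1 (fun x => by rw [one_mul]; exact hT x)
  have hF : ∀ x : AlgTensor A B, F (ofAlg x) = T x := extendL_ofAlg _ _ _
  have h1 : F 1 = 1 := (hF 1).trans (map_one T)
  { toFun := F
    map_one' := h1
    map_mul' := fun x y => by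
      refine induction₂ x y (p := fun x y => F (x * y) = F x * F y)
        (isClosed_eq (by fun_prop) (by fun_prop)) fun x y => ?_
      rw [← ofAlg_mul, hF, hF, hF]
      exact map_mul T _ _
    map_zero' := map_zero F
    map_add' := map_add F
    commutes' := fun r => by
      rw [Algebra.algebraMap_eq_smul_one, Algebra.algebraMap_eq_smul_one, map_smul, h1]
    map_star' := fun x => by
      refine induction x (p := fun x => F (star x) = star (F x))
        (isClosed_eq (by fun_prop) (by fun_prop)) fun x => ?_
      rw [star_ofAlg, hF, hF]
      exact hs x }

theorem extendHom_ofAlg (T : A ⊗[ℂ] B →ₐ[ℂ] E) (hs : ∀ x, T (star x) = star (T x))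
    (hT : ∀ x, ‖T x‖ ≤ spatialNorm x) (x : AlgTensor A B) :
    extendHom T hs hT (ofAlg x) = T x :=
  extendL_ofAlg _ _ _ _

theorem extendHom_tmul (T : A ⊗[ℂ] B →ₐ[ℂ] E) (hs : ∀ x, T (star x) = star (T x))
    (hT : ∀ x, ‖T x‖ ≤ spatialNorm x) (a : A) (b : B) :
    extendHom T hs hT (tmul a b) = T (a ⊗ₜ b) :=
  extendL_ofAlg _ _ _ _

end SpatialTensor

/-- Pulling a representation back along a `*`-homomorphism. -/
def Rep.comp {A A' : Type u} [CStarAlgebra A] [CStarAlgebra A'] (ρ : Rep A') (f : A →⋆ₐ[ℂ] A') :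
    Rep A where
  H := ρ.H
  π := ρ.π.comp f

namespace SpatialTensor

variable {A B A' B' E : Type u} [CStarAlgebra A] [CStarAlgebra B] [CStarAlgebra A']
  [CStarAlgebra B'] [CStarAlgebra E]

/-- The canonical map of the algebraic into the spatial tensor product, as an algebra map. -/
def ofAlgHom (A B : Type u) [CStarAlgebra A] [CStarAlgebra B] :
    A ⊗[ℂ] B →ₐ[ℂ] SpatialTensor A B where
  toFun x := ofAlg x
  map_one' := ofAlg_one
  map_mul' := ofAlg_mul
  map_zero' := ofAlg_zero
  map_add' := ofAlg_add
  commutes' r := by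
    rw [Algebra.algebraMap_eq_smul_one, Algebra.algebraMap_eq_smul_one]
    exact ofAlg_smul r 1

theorem algRep_map (f : A →⋆ₐ[ℂ] A') (g : B →⋆ₐ[ℂ] B') (ρ : Rep A') (σ : Rep B')
    (x : A ⊗[ℂ] B) :
    algRep ρ σ (Algebra.TensorProduct.map f.toAlgHom g.toAlgHom x) =
      algRep (ρ.comp f) (σ.comp g) x := by
  induction x with
  | zero => simp only [map_zero]; rfl
  | add x y hx hy => simp only [map_add, hx, hy]; rfl
  | tmul a b => rfl

/-- The `*`-homomorphism `f ⊗ g` between spatial tensor products. -/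
def map (f : A →⋆ₐ[ℂ] A') (g : B →⋆ₐ[ℂ] B') : SpatialTensor A B →⋆ₐ[ℂ] SpatialTensor A' B' :=
  extendHom ((ofAlgHom A' B').comp (Algebra.TensorProduct.map f.toAlgHom g.toAlgHom))
    (fun x => by
      induction x with
      | zero => simp
      | add x y hx hy => simp only [map_add, star_add, hx, hy]
      | tmul a b =>
        change tmul (f (star a)) (g (star b)) = star (tmul (f a) (g b))
        rw [star_tmul, map_star, map_star])
    (fun x => (norm_ofAlg _).le.trans <| spatialNorm_le fun ρ σ =>
      (congrArg norm (algRep_map f g ρ σ x)).le.trans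
        (le_spatialNorm (ρ.comp f) (σ.comp g) x))

theorem map_tmul (f : A →⋆ₐ[ℂ] A') (g : B →⋆ₐ[ℂ] B') (a : A) (b : B) :
    map f g (tmul a b) = tmul (f a) (g b) :=
  extendHom_tmul _ _ _ a b

/-- The representation `ρ ⊗ σ` of the spatial tensor product. -/
def rep (ρ : Rep A) (σ : Rep B) :
    SpatialTensor A B →⋆ₐ[ℂ] (HilbertTensor ρ.H σ.H →L[ℂ] HilbertTensor ρ.H σ.H) :=
  extendHom (algRep ρ σ) (algRep_star ρ σ) (le_spatialNorm ρ σ)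

theorem rep_tmul (ρ : Rep A) (σ : Rep B) (a : A) (b : B) :
    rep ρ σ (tmul a b) = opTensor (ρ.π a) (σ.π b) :=
  extendHom_tmul _ _ _ a b

/-- The representations `ρ ⊗ σ` separate the points of the spatial tensor product. -/
theorem eq_zero_of_rep (x : SpatialTensor A B) (h : ∀ ρ σ, rep ρ σ x = 0) : x = 0 := by
  rw [← norm_le_zero_iff]
  refine le_of_forall_pos_le_add fun ε hε => ?_
  obtain ⟨y, hy⟩ := denseRange_ofAlg.exists_dist_lt x (half_pos hε)
  rw [dist_eq_norm] at hy
  have h1 : ‖ofAlg y‖ ≤ ε / 2 := by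
    rw [norm_ofAlg]
    refine spatialNorm_le fun ρ σ => ?_
    have : algRep ρ σ y = rep ρ σ (ofAlg y - x) := by
      rw [map_sub, h, sub_zero]
      exact (extendHom_ofAlg _ _ _ y).symm
    rw [this]
    refine (NonUnitalStarAlgHom.norm_apply_le (rep ρ σ) _).trans ?_
    rw [norm_sub_rev]
    exact hy.le
  calc ‖x‖ = ‖(x - ofAlg y) + ofAlg y‖ := by rw [sub_add_cancel]
    _ ≤ ‖x - ofAlg y‖ + ‖ofAlg y‖ := norm_add_le _ _
    _ ≤ 0 + ε := by linarith

end SpatialTensor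

end CQG

namespace CQG

/-- A positive (bounded) linear functional on a C*-algebra. -/
structure PosFunctional (A : Type u) [CStarAlgebra A] extends A →L[ℂ] ℂ where
  nonneg' : ∀ a : A, 0 ≤ toContinuousLinearMap (star a * a)

namespace PosFunctional

variable {A : Type u} [CStarAlgebra A]

instance : CoeFun (PosFunctional A) fun _ => A → ℂ := ⟨fun φ => φ.toContinuousLinearMap⟩

end PosFunctional

section GNS

variable {A : Type u} [CStarAlgebra A]

/-- The vector functional `a ↦ ⟨ξ, ρ(a) ξ⟩` of a representation. -/
def Rep.vec (ρ : Rep A) (ξ : ρ.H) : PosFunctional A where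
  toContinuousLinearMap :=
    LinearMap.mkContinuous
      { toFun := fun a => ⟪ξ, ρ.π a ξ⟫_ℂ
        map_add' := fun a b => by simp
        map_smul' := fun c a => by simp }
      (‖ξ‖ * ‖ξ‖) fun a => by
        refine (norm_inner_le_norm _ _).trans ?_
        have h1 : ‖ρ.π a ξ‖ ≤ ‖a‖ * ‖ξ‖ :=
          ((ρ.π a).le_opNorm ξ).trans (mul_le_mul_of_nonneg_right (ρ.norm_le a) (norm_nonneg _))
        calc ‖ξ‖ * ‖ρ.π a ξ‖ ≤ ‖ξ‖ * (‖a‖ * ‖ξ‖) :=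
              mul_le_mul_of_nonneg_left h1 (norm_nonneg _)
          _ = _ := by ring
  nonneg' a := by
    change 0 ≤ ⟪ξ, ρ.π (star a * a) ξ⟫_ℂ
    rw [map_mul, map_star, mul_apply_eq_comp, ContinuousLinearMap.star_eq_adjoint,
      ContinuousLinearMap.adjoint_inner_right]
    rw [inner_self_eq_norm_sq_to_K, Complex.nonneg_iff]
    constructor
    · have : ((‖ρ.π a ξ‖ : ℂ) ^ 2).re = ‖ρ.π a ξ‖ ^ 2 := by norm_cast
      exact this ▸ sq_nonneg _
    · have : ((‖ρ.π a ξ‖ : ℂ) ^ 2).im = 0 := by norm_cast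
      exact this.symm

theorem Rep.vec_apply (ρ : Rep A) (ξ : ρ.H) (a : A) : ρ.vec ξ a = ⟪ξ, ρ.π a ξ⟫_ℂ := rfl

/-- The GNS construction. -/
theorem PosFunctional.exists_rep (φ : PosFunctional A) :
    ∃ (ρ : Rep A) (ξ : ρ.H), ∀ a, φ a = ⟪ξ, ρ.π a ξ⟫_ℂ := by
  let _ := CStarAlgebra.spectralOrder A
  have _ := CStarAlgebra.spectralOrderedRing A
  have hpos : ∀ a : A, 0 ≤ a → 0 ≤ φ a := fun a ha => by
    obtain ⟨b, rfl⟩ := CStarAlgebra.nonneg_iff_eq_star_mul_self.mp ha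
    exact φ.nonneg' b
  let f : A →ₚ[ℂ] ℂ := PositiveLinearMap.mk₀ φ.toContinuousLinearMap.toLinearMap hpos
  refine ⟨⟨f.GNS, f.gnsStarAlgHom⟩, ((f.toPreGNS 1 : f.PreGNS) : f.GNS), fun a => ?_⟩
  have h1 : f.gnsStarAlgHom a ((f.toPreGNS 1 : f.PreGNS) : f.GNS) =
      ((f.toPreGNS a : f.PreGNS) : f.GNS) := by
    have := f.gnsNonUnitalStarAlgHom_apply_coe (a := a) (b := f.toPreGNS 1)
    refine this.trans ?_
    simp [PositiveLinearMap.leftMulMapPreGNS]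
  change φ a = ⟪((f.toPreGNS 1 : f.PreGNS) : f.GNS),
    f.gnsStarAlgHom a ((f.toPreGNS 1 : f.PreGNS) : f.GNS)⟫_ℂ
  rw [h1, UniformSpace.Completion.inner_coe, PositiveLinearMap.preGNS_inner_def]
  simp
  rfl

/-- A norm-one functional that takes the value one at the unit is positive. -/
theorem nonneg_of_norm_le_one (f : A →L[ℂ] ℂ) (hf : ‖f‖ ≤ 1) (h1 : f 1 = 1) (a : A) :
    0 ≤ f (star a * a) := by
  let _ := CStarAlgebra.spectralOrder A
  have _ := CStarAlgebra.spectralOrderedRing A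
  have him : ∀ c : A, IsSelfAdjoint c → (f c).im = 0 := by
    intro c hc
    by_contra hne
    have key : ∀ t : ℝ, ((f c).im + t) ^ 2 ≤ ‖c‖ ^ 2 + t ^ 2 * ‖(1 : A)‖ := by
      intro t
      have e1 : f (c + (Complex.I * t) • 1) = f c + Complex.I * t := by
        rw [map_add, map_smul, h1, smul_eq_mul, mul_one]
      have e2 : star (c + (Complex.I * t) • (1 : A)) * (c + (Complex.I * t) • 1) =
          c * c + (t ^ 2 : ℂ) • 1 := by
        rw [star_add, hc.star_eq, star_smul, star_one]
        simp only [add_mul, mul_add, smul_mul_assoc, mul_smul_comm, one_mul, mul_one, smul_add,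
          smul_smul]
        have e3 : star (Complex.I * (t : ℂ)) = -(Complex.I * t) := by simp
        rw [e3, neg_smul]
        have e4 : Complex.I * (t : ℂ) * -(Complex.I * t) = t ^ 2 := by
          linear_combination (-(t : ℂ) ^ 2) * Complex.I_mul_I
        rw [e4]
        abel
      have e5 : ‖c + (Complex.I * t) • (1 : A)‖ ^ 2 ≤ ‖c‖ ^ 2 + t ^ 2 * ‖(1 : A)‖ := by
        rw [sq, ← CStarRing.norm_star_mul_self, e2]
        refine (norm_add_le _ _).trans (add_le_add ?_ ?_)
        · rw [sq]; exact norm_mul_le _ _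
        · rw [norm_smul]; simp
      have e6 : ‖f c + Complex.I * t‖ ≤ ‖c + (Complex.I * t) • (1 : A)‖ := by
        rw [← e1]
        refine (f.le_opNorm _).trans ?_
        exact mul_le_of_le_one_left (norm_nonneg _) hf
      have e7 : |(f c).im + t| ≤ ‖f c + Complex.I * t‖ := by
        have := Complex.abs_im_le_norm (f c + Complex.I * t)
        simpa using this
      calc ((f c).im + t) ^ 2 = |(f c).im + t| ^ 2 := (sq_abs _).symm
        _ ≤ ‖c + (Complex.I * t) • (1 : A)‖ ^ 2 := by
          gcongr; exact e7.trans e6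
        _ ≤ _ := e5
    have hn : ‖(1 : A)‖ ≤ 1 := by
      rcases subsingleton_or_nontrivial A with h | h
      · rw [Subsingleton.elim (1 : A) 0]; simp
      · exact CStarRing.norm_one.le
    have h3 := key (((‖c‖ ^ 2 + 1)) / (f c).im)
    have h4 : (((‖c‖ ^ 2 + 1)) / (f c).im) ^ 2 * ‖(1 : A)‖ ≤ (((‖c‖ ^ 2 + 1)) / (f c).im) ^ 2 :=
      mul_le_of_le_one_right (sq_nonneg _) hn
    have h5 : (f c).im * (((‖c‖ ^ 2 + 1)) / (f c).im) = ‖c‖ ^ 2 + 1 := by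
      field_simp
    nlinarith [sq_nonneg (f c).im, sq_nonneg ‖c‖]
  have hsa : IsSelfAdjoint (star a * a) := IsSelfAdjoint.star_mul_self a
  set c := star a * a with hc
  have hc0 : 0 ≤ c := star_mul_self_nonneg a
  have hre : 0 ≤ (f c).re := by
    have h2 : ‖algebraMap ℝ A ‖c‖ - c‖ ≤ ‖c‖ := by
      have hle : c ≤ algebraMap ℝ A ‖c‖ := hsa.le_algebraMap_norm_self
      have h3 : algebraMap ℝ A ‖c‖ - c ≤ algebraMap ℝ A ‖c‖ := sub_le_self _ hc0
      have h4 := CStarAlgebra.norm_le_norm_of_nonneg_of_le (sub_nonneg.mpr hle) h3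
      refine h4.trans ?_
      rw [Algebra.algebraMap_eq_smul_one, norm_smul, norm_norm]
      refine mul_le_of_le_one_right (norm_nonneg _) ?_
      rcases subsingleton_or_nontrivial A with h | h
      · rw [Subsingleton.elim (1 : A) 0]; simp
      · exact CStarRing.norm_one.le
    have h5 : f (algebraMap ℝ A ‖c‖ - c) = ‖c‖ - f c := by
      rw [map_sub, Algebra.algebraMap_eq_smul_one, ← Complex.coe_smul, map_smul, h1, smul_eq_mul,
        mul_one]
    have h6 : ‖(‖c‖ : ℂ) - f c‖ ≤ ‖c‖ := by
      rw [← h5]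
      exact (f.le_opNorm _).trans ((mul_le_of_le_one_left (norm_nonneg _) hf).trans h2)
    have h7 := (Complex.re_le_norm ((‖c‖ : ℂ) - f c)).trans h6
    simp only [Complex.sub_re, Complex.ofReal_re] at h7
    linarith
  rw [Complex.nonneg_iff]
  exact ⟨hre, (him c hsa).symm⟩

/-- There are enough representations. -/
theorem exists_rep_norm (b : A) : ∃ ρ : Rep A, ‖b‖ ≤ ‖ρ.π b‖ := by
  rcases subsingleton_or_nontrivial A with h | h
  · exact ⟨Rep.triv A, by rw [Subsingleton.elim b 0]; simp⟩
  let _ := CStarAlgebra.spectralOrder A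
  have _ := CStarAlgebra.spectralOrderedRing A
  set c := star b * b with hc
  have hc0 : 0 ≤ c := star_mul_self_nonneg b
  have hn : ‖1 + c‖ = 1 + ‖c‖ := by
    apply le_antisymm
    · exact (norm_add_le _ _).trans (by rw [CStarRing.norm_one])
    · have h1 : 1 ≤ ‖1 + c‖ := by
        have := CStarAlgebra.norm_le_norm_of_nonneg_of_le zero_le_one
          (le_add_of_nonneg_right hc0 : (1 : A) ≤ 1 + c)
        rwa [CStarRing.norm_one] at this
      have h2 : ‖c‖ ≤ ‖1 + c‖ - 1 := by
        rw [CStarAlgebra.norm_le_iff_le_algebraMap c (sub_nonneg.mpr h1) hc0, map_sub, map_one,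
          le_sub_iff_add_le, add_comm]
        exact IsSelfAdjoint.le_algebraMap_norm_self
          (IsSelfAdjoint.of_nonneg (add_nonneg zero_le_one hc0))
      linarith
  obtain ⟨f, hf1, hf2⟩ := exists_dual_vector'' ℂ (1 + c)
  rw [hn, map_add] at hf2
  have g1 : ‖f 1‖ ≤ 1 := (f.le_opNorm _).trans (by rw [CStarRing.norm_one, mul_one]; exact hf1)
  have g2 : ‖f c‖ ≤ ‖c‖ := (f.le_opNorm _).trans (mul_le_of_le_one_left (norm_nonneg _) hf1)
  have hre : (f 1).re + (f c).re = 1 + ‖c‖ := by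
    have := congrArg Complex.re hf2
    simpa using this
  have r1 : (f 1).re = 1 := by
    linarith [(Complex.re_le_norm (f 1)), Complex.re_le_norm (f c)]
  have r2 : (f c).re = ‖c‖ := by linarith
  have q1 : f 1 = 1 := by
    have h3 := Complex.sq_norm (f 1)
    rw [Complex.normSq_apply, r1] at h3
    have h4 : (f 1).im = 0 := by nlinarith [norm_nonneg (f 1)]
    exact Complex.ext (by simp [r1]) (by simp [h4])
  let φ : PosFunctional A := ⟨f, nonneg_of_norm_le_one f hf1 q1⟩
  obtain ⟨ρ, ξ, hξ⟩ := φ.exists_rep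
  refine ⟨ρ, ?_⟩
  have n1 : ‖ξ‖ ^ 2 = 1 := by
    have h3 : φ 1 = 1 := q1
    rw [hξ 1, map_one, one_apply_eq_self, inner_self_eq_norm_sq_to_K] at h3
    have h4 : ((‖ξ‖ ^ 2 : ℝ) : ℂ) = (1 : ℝ) := by
      rw [Complex.ofReal_pow, Complex.ofReal_one]; exact h3
    exact Complex.ofReal_injective h4
  have n1' : ‖ξ‖ = 1 := by nlinarith [norm_nonneg ξ]
  have n2 : ‖b‖ ^ 2 = ‖ρ.π b ξ‖ ^ 2 := by
    have h3 : φ c = ⟪ξ, ρ.π c ξ⟫_ℂ := hξ c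
    have h4 : ⟪ξ, ρ.π c ξ⟫_ℂ = ((‖ρ.π b ξ‖ : ℂ)) ^ 2 := by
      rw [hc, map_mul, map_star, mul_apply_eq_comp, ContinuousLinearMap.star_eq_adjoint,
        ContinuousLinearMap.adjoint_inner_right, inner_self_eq_norm_sq_to_K]
      rfl
    have h5 : (φ c).re = ‖c‖ := r2
    rw [h3, h4] at h5
    rw [sq ‖b‖, ← CStarRing.norm_star_mul_self, ← hc, ← h5]
    exact_mod_cast rfl
  have n3 : ‖b‖ = ‖ρ.π b ξ‖ := by
    nlinarith [norm_nonneg b, norm_nonneg (ρ.π b ξ)]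
  rw [n3]
  exact ((ρ.π b).le_opNorm ξ).trans (by rw [n1', mul_one])

end GNS

end CQG

namespace CQG

namespace SpatialTensor

variable {A B C : Type u} [CStarAlgebra A] [CStarAlgebra B] [CStarAlgebra C]

theorem continuous_hom {A : Type*} {B : Type*} [CStarAlgebra A] [CStarAlgebra B]
    (f : A →⋆ₐ[ℂ] B) : Continuous f :=
  AddMonoidHomClass.continuous_of_bound f 1 fun a => by
    rw [one_mul]; exact NonUnitalStarAlgHom.norm_apply_le f a

/-- `a ⊗ b ↦ φ(a) b` on the algebraic tensor product. -/
def algLeftSlice (φ : PosFunctional A) : A ⊗[ℂ] B →ₗ[ℂ] B :=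
  TensorProduct.lift (LinearMap.mk₂ ℂ (fun a b => φ a • b)
    (fun a a' b => by simp [add_smul]) (fun c a b => by simp [mul_smul])
    (fun a b b' => smul_add _ _ _) (fun c a b => smul_comm (φ a) c b))

theorem algLeftSlice_tmul (φ : PosFunctional A) (a : A) (b : B) :
    algLeftSlice φ (a ⊗ₜ b) = φ a • b := rfl

/-- `a ⊗ b ↦ ψ(b) a` on the algebraic tensor product. -/
def algRightSlice (ψ : PosFunctional B) : A ⊗[ℂ] B →ₗ[ℂ] A :=
  TensorProduct.lift (LinearMap.mk₂ ℂ (fun a b => ψ b • a)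
    (fun a a' b => smul_add _ _ _) (fun c a b => smul_comm (ψ b) c a)
    (fun a b b' => by simp [add_smul]) (fun c a b => by simp [mul_smul]))

theorem algRightSlice_tmul (ψ : PosFunctional B) (a : A) (b : B) :
    algRightSlice ψ (a ⊗ₜ b) = ψ b • a := rfl

theorem norm_pi_le_of_inner {ρ : Rep A} {a : A} {N : ℝ} (hN : 0 ≤ N)
    (h : ∀ ζ η : ρ.H, ‖⟪ζ, ρ.π a η⟫_ℂ‖ ≤ N * (‖ζ‖ * ‖η‖)) : ‖ρ.π a‖ ≤ N := by
  refine ContinuousLinearMap.opNorm_le_bound _ hN fun η => ?_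
  have h1 := h (ρ.π a η) η
  rw [inner_self_eq_norm_sq_to_K, norm_pow] at h1
  have h2 : ‖((‖ρ.π a η‖ : ℝ) : ℂ)‖ = ‖ρ.π a η‖ := by simp
  have h3 : ‖ρ.π a η‖ ^ 2 ≤ N * (‖ρ.π a η‖ * ‖η‖) := by
    rw [← h2]; exact h2.symm ▸ h1
  rcases eq_or_lt_of_le (norm_nonneg (ρ.π a η)) with h0 | h0
  · rw [← h0]; positivity
  · nlinarith

theorem inner_algRep_le {ρ : Rep A} {σ : Rep B} (x : A ⊗[ℂ] B) (ξ ξ' : ρ.H) (η η' : σ.H) :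
    ‖⟪HilbertTensor.of (ξ ⊗ₜ[ℂ] η), algRep ρ σ x (HilbertTensor.of (ξ' ⊗ₜ[ℂ] η'))⟫_ℂ‖ ≤
      ‖ξ‖ * ‖η‖ * (spatialNorm x * (‖ξ'‖ * ‖η'‖)) := by
  refine (norm_inner_le_norm _ _).trans ?_
  rw [LinearIsometry.norm_map, TensorProduct.norm_tmul]
  refine mul_le_mul_of_nonneg_left ?_ (by positivity)
  refine ((algRep ρ σ x).le_opNorm _).trans ?_
  rw [LinearIsometry.norm_map, TensorProduct.norm_tmul]
  exact mul_le_mul_of_nonneg_right (le_spatialNorm ρ σ x) (by positivity)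

theorem sq_norm_of_rep {φ : PosFunctional A} {ρ : Rep A} {ξ : ρ.H}
    (h : ∀ a, φ a = ⟪ξ, ρ.π a ξ⟫_ℂ) : (φ 1).re = ‖ξ‖ * ‖ξ‖ := by
  rw [h 1, map_one, one_apply_eq_self, ← sq]
  exact inner_self_eq_norm_sq (𝕜 := ℂ) ξ

theorem norm_algLeftSlice_le (φ : PosFunctional A) (x : A ⊗[ℂ] B) :
    ‖algLeftSlice φ x‖ ≤ (φ 1).re * spatialNorm x := by
  obtain ⟨ρ, ξ, hξ⟩ := φ.exists_rep
  obtain ⟨σ, hσ⟩ := exists_rep_norm (algLeftSlice φ x)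
  rw [sq_norm_of_rep hξ]
  refine hσ.trans (norm_pi_le_of_inner (mul_nonneg (by positivity) (spatialNorm_nonneg x)) ?_)
  intro ζ η
  have key : ∀ y : A ⊗[ℂ] B, ⟪ζ, σ.π (algLeftSlice φ y) η⟫_ℂ =
      ⟪HilbertTensor.of (ξ ⊗ₜ[ℂ] ζ), algRep ρ σ y (HilbertTensor.of (ξ ⊗ₜ[ℂ] η))⟫_ℂ := by
    intro y
    induction y with
    | zero => simp
    | add y z hy hz => simp only [map_add, add_apply, inner_add_right, hy, hz]
    | tmul a b =>
      rw [algLeftSlice_tmul, algRep_tmul, opTensor_of, LinearIsometry.inner_map_map,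
        TensorProduct.mapL_tmul, TensorProduct.inner_tmul, map_smul, smul_apply, inner_smul_right,
        hξ]
  rw [key]
  refine (inner_algRep_le x ξ ξ ζ η).trans (le_of_eq ?_)
  ring

theorem norm_algRightSlice_le (ψ : PosFunctional B) (x : A ⊗[ℂ] B) :
    ‖algRightSlice ψ x‖ ≤ (ψ 1).re * spatialNorm x := by
  obtain ⟨σ, η, hη⟩ := ψ.exists_rep
  obtain ⟨ρ, hρ⟩ := exists_rep_norm (algRightSlice ψ x)
  rw [sq_norm_of_rep hη]
  refine hρ.trans (norm_pi_le_of_inner (mul_nonneg (by positivity) (spatialNorm_nonneg x)) ?_)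
  intro ζ ξ
  have key : ∀ y : A ⊗[ℂ] B, ⟪ζ, ρ.π (algRightSlice ψ y) ξ⟫_ℂ =
      ⟪HilbertTensor.of (ζ ⊗ₜ[ℂ] η), algRep ρ σ y (HilbertTensor.of (ξ ⊗ₜ[ℂ] η))⟫_ℂ := by
    intro y
    induction y with
    | zero => simp
    | add y z hy hz => simp only [map_add, add_apply, inner_add_right, hy, hz]
    | tmul a b =>
      rw [algRightSlice_tmul, algRep_tmul, opTensor_of, LinearIsometry.inner_map_map,
        TensorProduct.mapL_tmul, TensorProduct.inner_tmul, map_smul, smul_apply, inner_smul_right,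
        hη, mul_comm]
  rw [key]
  refine (inner_algRep_le x ζ ξ η η).trans (le_of_eq ?_)
  ring

/-- The slice map `φ ⊗ ι : A ⊗ B → B`. -/
def leftSlice (φ : PosFunctional A) : SpatialTensor A B →L[ℂ] B :=
  extendL (algLeftSlice φ) _ (norm_algLeftSlice_le φ)

/-- The slice map `ι ⊗ ψ : A ⊗ B → A`. -/
def rightSlice (ψ : PosFunctional B) : SpatialTensor A B →L[ℂ] A :=
  extendL (algRightSlice ψ) _ (norm_algRightSlice_le ψ)

theorem leftSlice_tmul (φ : PosFunctional A) (a : A) (b : B) :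
    leftSlice φ (tmul a b) = φ a • b := extendL_tmul _ _ _ a b

theorem rightSlice_tmul (ψ : PosFunctional B) (a : A) (b : B) :
    rightSlice ψ (tmul a b) = ψ b • a := extendL_tmul _ _ _ a b

theorem sesq_eq_zero {V : Type*} [AddCommGroup V] [Module ℂ V] (s : V → V → ℂ)
    (hl : ∀ x y z, s (x + y) z = s x z + s y z) (hr : ∀ x y z, s x (y + z) = s x y + s x z)
    (hls : ∀ (c : ℂ) x y, s (c • x) y = star c * s x y) (hrs : ∀ (c : ℂ) x y, s x (c • y) = c * s x y)
    (h0 : ∀ x, s x x = 0) (x y : V) : s x y = 0 := by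
  have h1 := h0 (x + y)
  have h2 := h0 (x + Complex.I • y)
  simp only [hl, hr, hls, hrs, h0] at h1 h2
  simp only [Complex.star_def, Complex.conj_I] at h2
  have h3 : Complex.I * s x y - Complex.I * s y x = 0 := by linear_combination h2
  have h4 : Complex.I * (2 * s x y) = 0 := by linear_combination h3 + Complex.I * h1
  simpa using h4

theorem op_eq_zero {H K : Type u} [NormedAddCommGroup H] [InnerProductSpace ℂ H]
    [NormedAddCommGroup K] [InnerProductSpace ℂ K]
    (T : HilbertTensor H K →L[ℂ] HilbertTensor H K)
    (h : ∀ (ξ : H) (η : K), ⟪HilbertTensor.of (ξ ⊗ₜ[ℂ] η), T (HilbertTensor.of (ξ ⊗ₜ[ℂ] η))⟫_ℂ = 0) :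
    T = 0 := by
  have h1 : ∀ (ξ ξ' : H) (η : K),
      ⟪HilbertTensor.of (ξ ⊗ₜ[ℂ] η), T (HilbertTensor.of (ξ' ⊗ₜ[ℂ] η))⟫_ℂ = 0 := fun ξ ξ' η =>
    sesq_eq_zero (fun ξ ξ' : H =>
        ⟪HilbertTensor.of (ξ ⊗ₜ[ℂ] η), T (HilbertTensor.of (ξ' ⊗ₜ[ℂ] η))⟫_ℂ)
      (fun x y z => by simp only [TensorProduct.add_tmul, map_add, inner_add_left])
      (fun x y z => by simp only [TensorProduct.add_tmul, map_add, inner_add_right])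
      (fun c x y => by
        simp only [← TensorProduct.smul_tmul', map_smul, inner_smul_left]; rfl)
      (fun c x y => by simp only [← TensorProduct.smul_tmul', map_smul, inner_smul_right])
      (fun x => h x η) ξ ξ'
  have h2 : ∀ (ξ ξ' : H) (η η' : K),
      ⟪HilbertTensor.of (ξ ⊗ₜ[ℂ] η), T (HilbertTensor.of (ξ' ⊗ₜ[ℂ] η'))⟫_ℂ = 0 :=
    fun ξ ξ' η η' =>
    sesq_eq_zero (fun η η' : K =>
        ⟪HilbertTensor.of (ξ ⊗ₜ[ℂ] η), T (HilbertTensor.of (ξ' ⊗ₜ[ℂ] η'))⟫_ℂ)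
      (fun x y z => by simp only [TensorProduct.tmul_add, map_add, inner_add_left])
      (fun x y z => by simp only [TensorProduct.tmul_add, map_add, inner_add_right])
      (fun c x y => by
        simp only [TensorProduct.tmul_smul, map_smul, inner_smul_left]; rfl)
      (fun c x y => by simp only [TensorProduct.tmul_smul, map_smul, inner_smul_right])
      (fun x => h1 ξ ξ' x) η η'
  apply opTensor_ext
  intro w
  rw [zero_apply]
  have h3 : ∀ v : H ⊗[ℂ] K, ⟪HilbertTensor.of v, T (HilbertTensor.of w)⟫_ℂ = 0 := by
    intro v
    induction v with
    | zero => simp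
    | add x y hx hy => rw [map_add, inner_add_left, hx, hy, add_zero]
    | tmul ξ η =>
      induction w with
      | zero => simp
      | add x y hx hy => rw [map_add, map_add, inner_add_right, hx, hy, add_zero]
      | tmul ξ' η' => exact h2 ξ ξ' η η'
  have h4 : ∀ z, ⟪z, T (HilbertTensor.of w)⟫_ℂ = 0 := fun z =>
    HilbertTensor.induction z (p := fun z => ⟪z, T (HilbertTensor.of w)⟫_ℂ = 0)
      (isClosed_eq (by fun_prop) (by fun_prop)) h3
  exact inner_self_eq_zero.mp (h4 _)

/-- Slices by positive functionals separate points. -/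
theorem eq_zero_of_slices (x : SpatialTensor A B)
    (h : ∀ (φ : PosFunctional A) (ψ : PosFunctional B), ψ (leftSlice φ x) = 0) : x = 0 := by
  refine eq_zero_of_rep x fun ρ σ => op_eq_zero _ fun ξ η => ?_
  rw [← h (ρ.vec ξ) (σ.vec η)]
  refine induction_tmul x (p := fun x =>
    ⟪HilbertTensor.of (ξ ⊗ₜ[ℂ] η), rep ρ σ x (HilbertTensor.of (ξ ⊗ₜ[ℂ] η))⟫_ℂ =
      σ.vec η (leftSlice (ρ.vec ξ) x)) ?_ ?_ ?_ ?_
  · refine isClosed_eq ?_ (by fun_prop)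
    have : Continuous (rep ρ σ) := continuous_hom (rep ρ σ)
    fun_prop
  · simp
  · intro x y hx hy
    simp only [map_add, add_apply, inner_add_right, hx, hy]
  · intro a b
    rw [rep_tmul, leftSlice_tmul, opTensor_of, LinearIsometry.inner_map_map,
      TensorProduct.mapL_tmul, TensorProduct.inner_tmul, map_smul, smul_eq_mul, Rep.vec_apply,
      Rep.vec_apply]

end SpatialTensor

end CQG

namespace CQG

namespace SpatialTensor

section Assoc

variable (A B C : Type u) [CStarAlgebra A] [CStarAlgebra B] [CStarAlgebra C]

instance prodCStarAlgebra {M N : Type u} [CStarAlgebra M] [CStarAlgebra N] :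
    CStarAlgebra (M × N) where

/-- The pairs `(a ⊗ (b ⊗ c), (a ⊗ b) ⊗ c)`. -/
def assocGen : Set (SpatialTensor A (SpatialTensor B C) × SpatialTensor (SpatialTensor A B) C) :=
  {p | ∃ (a : A) (b : B) (c : C), p = (tmul a (tmul b c), tmul (tmul a b) c)}

/-- The graph of the associativity isomorphism: the closed `*`-algebra generated by the pairs
`(a ⊗ (b ⊗ c), (a ⊗ b) ⊗ c)`. -/
def assocGraph : StarSubalgebra ℂ
    (SpatialTensor A (SpatialTensor B C) × SpatialTensor (SpatialTensor A B) C) :=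
  (StarAlgebra.adjoin ℂ (assocGen A B C)).topologicalClosure

instance : IsClosed (assocGraph A B C : Set
    (SpatialTensor A (SpatialTensor B C) × SpatialTensor (SpatialTensor A B) C)) :=
  StarSubalgebra.isClosed_topologicalClosure _

variable {A B C}

theorem mem_assocGraph (a : A) (b : B) (c : C) :
    ((tmul a (tmul b c), tmul (tmul a b) c) :
      SpatialTensor A (SpatialTensor B C) × SpatialTensor (SpatialTensor A B) C) ∈
      assocGraph A B C :=
  StarSubalgebra.le_topologicalClosure _ (StarAlgebra.subset_adjoin ℂ _ ⟨a, b, c, rfl⟩)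

theorem adjoin_assocGen_le
    (x : SpatialTensor A (SpatialTensor B C) × SpatialTensor (SpatialTensor A B) C)
    (hx : x ∈ StarAlgebra.adjoin ℂ (assocGen A B C)) :
    x ∈ Submodule.span ℂ (assocGen A B C) := by
  have hmul : ∀ x ∈ Submodule.span ℂ (assocGen A B C), ∀ y ∈ Submodule.span ℂ (assocGen A B C),
      x * y ∈ Submodule.span ℂ (assocGen A B C) := by
    intro x hx y hy
    induction hx using Submodule.span_induction with
    | zero => rw [zero_mul]; exact zero_mem _
    | add x x' _ _ h1 h2 => rw [add_mul]; exact add_mem h1 h2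
    | smul c x _ h1 => rw [smul_mul_assoc]; exact Submodule.smul_mem _ _ h1
    | mem x hx =>
      induction hy using Submodule.span_induction with
      | zero => rw [mul_zero]; exact zero_mem _
      | add x x' _ _ h1 h2 => rw [mul_add]; exact add_mem h1 h2
      | smul c x _ h1 => rw [mul_smul_comm]; exact Submodule.smul_mem _ _ h1
      | mem y hy =>
        obtain ⟨a, b, c, rfl⟩ := hx
        obtain ⟨a', b', c', rfl⟩ := hy
        refine Submodule.subset_span ⟨a * a', b * b', c * c', ?_⟩
        simp only [Prod.mk_mul_mk, tmul_mul_tmul]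
  induction hx using StarAlgebra.adjoin_induction with
  | mem x h => exact Submodule.subset_span h
  | algebraMap r =>
    rw [Algebra.algebraMap_eq_smul_one]
    exact Submodule.smul_mem _ _ (Submodule.subset_span ⟨1, 1, 1, rfl⟩)
  | add x y _ _ h1 h2 => exact add_mem h1 h2
  | mul x y _ _ h1 h2 => exact hmul x h1 y h2
  | star x hx0 h1 =>
    clear hx0
    induction h1 using Submodule.span_induction with
    | zero => rw [star_zero]; exact zero_mem _
    | add x x' _ _ h1 h2 => rw [star_add]; exact add_mem h1 h2
    | smul c x _ h1 => rw [star_smul]; exact Submodule.smul_mem _ _ h1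
    | mem x hx =>
      obtain ⟨a, b, c, rfl⟩ := hx
      refine Submodule.subset_span ⟨star a, star b, star c, ?_⟩
      rw [Prod.star_def]
      simp only [star_tmul]

theorem assocGraph_slices (φ : PosFunctional A) (ψ : PosFunctional B) (ω : PosFunctional C)
    (p : SpatialTensor A (SpatialTensor B C) × SpatialTensor (SpatialTensor A B) C)
    (hp : p ∈ assocGraph A B C) :
    ω (leftSlice ψ (leftSlice φ p.1)) = ψ (leftSlice φ (rightSlice ω p.2)) := by
  have hcl : IsClosed {p : SpatialTensor A (SpatialTensor B C) × SpatialTensor (SpatialTensor A B) C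
      | ω (leftSlice ψ (leftSlice φ p.1)) = ψ (leftSlice φ (rightSlice ω p.2))} :=
    isClosed_eq (by fun_prop) (by fun_prop)
  refine closure_minimal ?_ hcl hp
  intro q hq
  have hq' := adjoin_assocGen_le q hq
  clear hq
  induction hq' using Submodule.span_induction with
  | zero => simp
  | add x y _ _ h1 h2 =>
    simp only [Set.mem_ofPred_eq] at h1 h2 ⊢
    simp only [Prod.fst_add, Prod.snd_add, map_add, h1, h2]
  | smul c x _ h1 =>
    simp only [Set.mem_ofPred_eq] at h1 ⊢
    simp only [Prod.smul_fst, Prod.smul_snd, map_smul, h1]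
  | mem x hx =>
    obtain ⟨a, b, c, rfl⟩ := hx
    simp only [Set.mem_ofPred_eq, leftSlice_tmul, rightSlice_tmul, map_smul, smul_eq_mul]
    ring

/-- The projection of the graph to the second factor. -/
def assocSnd : assocGraph A B C →⋆ₐ[ℂ] SpatialTensor (SpatialTensor A B) C :=
  (StarAlgHom.snd ℂ _ _).comp (assocGraph A B C).subtype

/-- The projection of the graph to the first factor. -/
def assocFst : assocGraph A B C →⋆ₐ[ℂ] SpatialTensor A (SpatialTensor B C) :=
  (StarAlgHom.fst ℂ _ _).comp (assocGraph A B C).subtype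

theorem assocSnd_injective : Function.Injective (assocSnd (A := A) (B := B) (C := C)) := by
  rw [injective_iff_map_eq_zero]
  rintro ⟨⟨m, n⟩, hp⟩ h0
  have hn : n = 0 := h0
  subst hn
  have hm : m = 0 := by
    refine eq_zero_of_slices m fun φ θ => ?_
    have : leftSlice φ m = 0 := by
      refine eq_zero_of_slices _ fun ψ ω => ?_
      rw [assocGraph_slices φ ψ ω _ hp]
      simp
    rw [this, map_zero]
  subst hm
  rfl

theorem assocSnd_surjective : Function.Surjective (assocSnd (A := A) (B := B) (C := C)) := by
  have hiso : Isometry (assocSnd (A := A) (B := B) (C := C)) :=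
    NonUnitalStarAlgHom.isometry _ assocSnd_injective
  have hcl : IsClosed (Set.range (assocSnd (A := A) (B := B) (C := C))) :=
    hiso.isClosedEmbedding.isClosed_range
  intro n
  refine induction_tmul n (p := fun n => n ∈ Set.range (assocSnd (A := A) (B := B) (C := C)))
    hcl ⟨0, map_zero _⟩ ?_ ?_
  · rintro _ _ ⟨x, rfl⟩ ⟨y, rfl⟩
    exact ⟨x + y, map_add _ _ _⟩
  · intro d c
    refine induction_tmul d (p := fun d => tmul d c ∈
      Set.range (assocSnd (A := A) (B := B) (C := C))) ?_ ?_ ?_ ?_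
    · refine hcl.preimage (f := fun d => tmul d c) ?_
      exact AddMonoidHomClass.continuous_of_bound
        (AddMonoidHom.mk' (fun d : SpatialTensor A B => tmul d c) fun x y => add_tmul x y c) ‖c‖
        fun d => (norm_tmul_le d c).trans (mul_comm _ _).le
    · exact ⟨0, by rw [map_zero, ← zero_smul ℂ (0 : SpatialTensor A B), smul_tmul, zero_smul]⟩
    · rintro x y ⟨u, hu⟩ ⟨v, hv⟩
      exact ⟨u + v, by rw [map_add, hu, hv, add_tmul]⟩
    · intro a b
      exact ⟨⟨_, mem_assocGraph a b c⟩, rfl⟩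

/-- The inverse of the projection of the graph to the second factor. -/
def assocEquiv : assocGraph A B C ≃⋆ₐ[ℂ] SpatialTensor (SpatialTensor A B) C :=
  StarAlgEquiv.ofBijective assocSnd ⟨assocSnd_injective, assocSnd_surjective⟩

/-- The associativity isomorphism `(A ⊗ B) ⊗ C → A ⊗ (B ⊗ C)`, `(a ⊗ b) ⊗ c ↦ a ⊗ (b ⊗ c)`. -/
def assoc : SpatialTensor (SpatialTensor A B) C →⋆ₐ[ℂ] SpatialTensor A (SpatialTensor B C) :=
  assocFst.comp (StarAlgHomClass.toStarAlgHom (assocEquiv (A := A) (B := B) (C := C)).symm)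

theorem assoc_tmul (a : A) (b : B) (c : C) :
    assoc (tmul (tmul a b) c) = tmul a (tmul b c) := by
  have h : assocEquiv.symm (tmul (tmul a b) c) = ⟨_, mem_assocGraph a b c⟩ := by
    rw [StarAlgEquiv.symm_apply_eq]
    rfl
  exact congrArg assocFst h

end Assoc

end SpatialTensor

end CQG

namespace CQG

open SpatialTensor

section Defs

variable {A C : Type u} [CStarAlgebra A] [CStarAlgebra C]

/-- The `*`-homomorphism `b ↦ 1 ⊗ b`. -/
def SpatialTensor.inclRight (A B : Type u) [CStarAlgebra A] [CStarAlgebra B] :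
    B →⋆ₐ[ℂ] SpatialTensor A B where
  toFun b := tmul 1 b
  map_one' := one_eq_tmul.symm
  map_mul' a b := by rw [tmul_mul_tmul, one_mul]
  map_zero' := by rw [← zero_smul ℂ (0 : B), tmul_smul, zero_smul]
  map_add' := tmul_add 1
  commutes' r := by
    rw [Algebra.algebraMap_eq_smul_one, Algebra.algebraMap_eq_smul_one, tmul_smul, one_eq_tmul]
  map_star' b := by rw [star_tmul, star_one]

/-- A `*`-character, viewed as a positive functional. -/
def charFunctional (χ : C →⋆ₐ[ℂ] ℂ) : PosFunctional C where
  toContinuousLinearMap := ⟨χ.toAlgHom.toLinearMap, continuous_hom χ⟩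
  nonneg' a := by
    change 0 ≤ χ (star a * a)
    rw [map_mul, map_star]
    exact star_mul_self_nonneg _

/-- The slice map `χ ⊗ ι : C ⊗ A → A` by a `*`-character, a `*`-homomorphism. -/
def charSlice (χ : C →⋆ₐ[ℂ] ℂ) : SpatialTensor C A →⋆ₐ[ℂ] A :=
  have h : ∀ x y : SpatialTensor C A, leftSlice (charFunctional χ) (x * y) =
      leftSlice (charFunctional χ) x * leftSlice (charFunctional χ) y := by
    intro x y
    refine induction_tmul x (p := fun x => leftSlice (charFunctional χ) (x * y) =
      leftSlice (charFunctional χ) x * leftSlice (charFunctional χ) y)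
      (isClosed_eq (by fun_prop) (by fun_prop)) (by simp)
      (fun x x' h h' => by rw [add_mul, map_add, map_add, add_mul, h, h']) fun c a => ?_
    refine induction_tmul y (p := fun y => leftSlice (charFunctional χ) (tmul c a * y) =
      leftSlice (charFunctional χ) (tmul c a) * leftSlice (charFunctional χ) y)
      (isClosed_eq (by fun_prop) (by fun_prop)) (by simp)
      (fun x x' h h' => by rw [mul_add, map_add, map_add, mul_add, h, h']) fun c' a' => ?_
    have e : charFunctional χ (c * c') = charFunctional χ c * charFunctional χ c' :=
      map_mul χ c c'
    rw [tmul_mul_tmul, leftSlice_tmul, leftSlice_tmul, leftSlice_tmul, e, smul_mul_smul_comm]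
  have h1 : leftSlice (charFunctional χ) (1 : SpatialTensor C A) = 1 := by
    have e : charFunctional χ 1 = 1 := map_one χ
    rw [one_eq_tmul, leftSlice_tmul, e, one_smul]
  { toFun := leftSlice (charFunctional χ)
    map_one' := h1
    map_mul' := h
    map_zero' := map_zero _
    map_add' := map_add _
    commutes' := fun r => by
      rw [Algebra.algebraMap_eq_smul_one, Algebra.algebraMap_eq_smul_one, map_smul, h1]
    map_star' := fun x => by
      refine induction_tmul x (p := fun x => leftSlice (charFunctional χ) (star x) =
        star (leftSlice (charFunctional χ) x)) (isClosed_eq (by fun_prop) (by fun_prop)) (by simp)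
        (fun x x' h h' => by rw [star_add, map_add, map_add, star_add, h, h']) fun c a => ?_
      have e : charFunctional χ (star c) = star (charFunctional χ c) := map_star χ c
      rw [star_tmul, leftSlice_tmul, leftSlice_tmul, e, star_smul] }

theorem charSlice_tmul (χ : C →⋆ₐ[ℂ] ℂ) (c : C) (a : A) :
    charSlice χ (tmul c a) = χ c • a := leftSlice_tmul _ c a

end Defs

/-- A compact quantum group structure on a unital C*-algebra `A`, in the sense of Woronowicz. -/
structure CompactQuantumGroup (A : Type u) [CStarAlgebra A] where
  /-- the coproduct -/
  Δ : A →⋆ₐ[ℂ] SpatialTensor A A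
  coassoc : ∀ a, assoc (map Δ (StarAlgHom.id ℂ A) (Δ a)) = map (StarAlgHom.id ℂ A) Δ (Δ a)
  dense_left : Dense (Submodule.span ℂ
    {x | ∃ b c : A, x = tmul b 1 * Δ c} : Set (SpatialTensor A A))
  dense_right : Dense (Submodule.span ℂ
    {x | ∃ b c : A, x = tmul 1 b * Δ c} : Set (SpatialTensor A A))

/-- A positive functional is faithful if it vanishes on no nonzero positive element. -/
def PosFunctional.IsFaithful {A : Type u} [CStarAlgebra A] (φ : PosFunctional A) : Prop :=
  ∀ a : A, φ (star a * a) = 0 → a = 0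

/-- The Haar state: the invariant state `h`, `(h ⊗ ι)Δ(a) = h(a)1 = (ι ⊗ h)Δ(a)`. -/
structure CompactQuantumGroup.IsHaarState {A : Type u} [CStarAlgebra A]
    (G : CompactQuantumGroup A) (h : PosFunctional A) : Prop where
  map_one : h 1 = 1
  left_inv : ∀ a, leftSlice h (G.Δ a) = h a • (1 : A)
  right_inv : ∀ a, rightSlice h (G.Δ a) = h a • (1 : A)

/-- An action of a compact quantum group on a unital C*-algebra `C`. -/
structure Action {A : Type u} [CStarAlgebra A] (G : CompactQuantumGroup A) (C : Type u)
    [CStarAlgebra C] where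
  δ : C →⋆ₐ[ℂ] SpatialTensor C A
  coassoc : ∀ c, assoc (map δ (StarAlgHom.id ℂ A) (δ c)) = map (StarAlgHom.id ℂ C) G.Δ (δ c)

namespace Action

variable {A C : Type u} [CStarAlgebra A] [CStarAlgebra C] {G : CompactQuantumGroup A}

/-- `(1 ⊗ A) δ(C)` spans a dense subspace of `C ⊗ A`. -/
def IsNondegenerate (α : Action G C) : Prop :=
  Dense (Submodule.span ℂ {x | ∃ (a : A) (c : C), x = tmul 1 a * α.δ c} :
    Set (SpatialTensor C A))

/-- The fixed point algebra consists of the scalars only. -/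
def IsErgodic (α : Action G C) : Prop :=
  ∀ c : C, α.δ c = tmul c 1 → ∃ z : ℂ, c = z • (1 : C)

/-- The map `T_χ = (χ ⊗ ι) ∘ δ : C → A`. -/
def orbitMap (α : Action G C) (χ : C →⋆ₐ[ℂ] ℂ) : C →⋆ₐ[ℂ] A := (charSlice χ).comp α.δ

/-- The closed two-sided ideal generated by the elements `T_χ(c) - χ(c) 1`. -/
def stabilizerIdeal (α : Action G C) (χ : C →⋆ₐ[ℂ] ℂ) : Set A :=
  closure (TwoSidedIdeal.span {a : A | ∃ c : C, a = α.orbitMap χ c - χ c • (1 : A)} : Set A)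

end Action

/-- A compact quantum subgroup of `G = (A, Δ)`: a unital C*-algebra `A'` with a unital
`*`-homomorphism `Δ' : A' → A' ⊗ A'` and a unital `*`-epimorphism `π : A → A'` such that
`(π ⊗ π) Δ = Δ' π`. -/
structure QuantumSubgroup {A : Type u} [CStarAlgebra A] (G : CompactQuantumGroup A) :
    Type (u + 1) where
  carrier : Type u
  [cstar : CStarAlgebra carrier]
  Δ' : carrier →⋆ₐ[ℂ] SpatialTensor carrier carrier
  π : A →⋆ₐ[ℂ] carrier
  surjective : Function.Surjective π
  compat : ∀ a, map π π (G.Δ a) = Δ' (π a)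

attribute [instance] QuantumSubgroup.cstar

namespace QuantumSubgroup

variable {A C : Type u} [CStarAlgebra A] [CStarAlgebra C] {G : CompactQuantumGroup A}

/-- The quantum right coset space `{T ∈ A : (π ⊗ ι)Δ(T) = 1 ⊗ T}`, the algebra of `K \ G`. -/
def rightCoset (K : QuantumSubgroup G) : StarSubalgebra ℂ A :=
  StarAlgHom.equalizer ((map K.π (StarAlgHom.id ℂ A)).comp G.Δ) (inclRight K.carrier A)

theorem mem_rightCoset (K : QuantumSubgroup G) (a : A) :
    a ∈ K.rightCoset ↔ map K.π (StarAlgHom.id ℂ A) (G.Δ a) = tmul 1 a := Iff.rfl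

instance (K : QuantumSubgroup G) : IsClosed (K.rightCoset : Set A) :=
  isClosed_eq (continuous_hom _) (continuous_hom _)

/-- The action of `G` on the quantum right coset space that is the restriction of the coproduct:
`η : A^K → A^K ⊗ A` becomes `Δ` after the inclusion `A^K ⊗ A → A ⊗ A`. -/
def IsQuotientAction (K : QuantumSubgroup G) (η : Action G K.rightCoset) : Prop :=
  ∀ x : K.rightCoset,
    map K.rightCoset.subtype (StarAlgHom.id ℂ A) (η.δ x) = G.Δ (x : A)

/-- `K` is the subgroup stabilizing the character `χ`: the kernel of `π : A → A'` is the closed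
two-sided ideal generated by the elements `T_χ(c) - χ(c) 1`; that is, `A' = A / J_χ`. -/
def IsStabilizer (K : QuantumSubgroup G) (α : Action G C) (χ : C →⋆ₐ[ℂ] ℂ) : Prop :=
  ∀ a : A, K.π a = 0 ↔ a ∈ α.stabilizerIdeal χ

end QuantumSubgroup

end CQG
end

/-!
Write `J_χ` for the stabilizer ideal. The quotient map `π : A → A / J_χ` turns `T_χ` into
`χ(·) 1`, and since `Δ ∘ T_χ = (T_χ ⊗ ι) ∘ δ`, this gives `(π ⊗ σ) Δ(T_χ(c)) = 1 ⊗ σ(T_χ(c))` for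
every `*`-homomorphism `σ`. For `σ = π` it shows that `Δ` descends to `A / J_χ`, and for `σ = ι`
that `T_χ` takes its values in `A^K`.

That `Δ` maps `A^K` into `A^K ⊗ A`, rather than merely into the elements of `A ⊗ A` whose right
slices lie in `A^K`, needs averaging. A left-invariant state `k` of the subgroup `K` exists by the
argument of Maes and Van Daele: Cesàro means of convolution powers yield a state absorbing a given
one, and hence everything dominated by it. Then `E = (kπ ⊗ ι) Δ` projects `A` onto `A^K` and
`Δ E = (E ⊗ ι) Δ`.

For injectivity, invariance of the Haar state `h` of `G` makes `(ι ⊗ h) δ(c* c)` a fixed point, so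
by ergodicity a scalar, and evaluating `χ` shows that this scalar is `h(T_χ(c)* T_χ(c))`. If
`T_χ(c) = 0`, then `(ι ⊗ h)(δ(c)* δ(c)) = 0`, which forces `δ(c) = 0` because `h` is faithful.
-/

noncomputable section

namespace CQG

section Quotient

variable {A B : Type u} [CStarAlgebra A] [CStarAlgebra B] (I : Ideal A)

/-- A left ideal that is closed under the involution; it is then automatically two-sided, but
two-sidedness is left to `Ideal.IsTwoSided`, which carries the ring structure of the quotient. -/
class IsStarIdeal : Prop where
  star_mem : ∀ a ∈ I, star a ∈ I

/-- A left ideal closed under the involution, as a non-unital `*`-subalgebra; when it is norm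
closed, this gives it approximate units. -/
def idealStarSubalgebra [IsStarIdeal I] : NonUnitalStarSubalgebra ℂ A where
  carrier := I
  add_mem' := I.add_mem
  zero_mem' := I.zero_mem
  mul_mem' _ hb := I.mul_mem_left _ hb
  smul_mem' c a ha := by
    rw [← one_mul a, ← smul_mul_assoc]
    exact I.mul_mem_left _ ha
  star_mem' ha := IsStarIdeal.star_mem _ ha

theorem exists_mem_ideal_norm_mul_one_sub_le [IsStarIdeal I] [hI : IsClosed (I : Set A)]
    {a : A} (ha : a ∈ I) {ε : ℝ} (hε : 0 < ε) :
    ∃ e ∈ I, star e = e ∧ ‖1 - e‖ ≤ 1 ∧ ‖a * (1 - e)‖ ≤ ε := by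
  let S := idealStarSubalgebra I
  have : IsClosed (S : Set A) := hI
  let _ : NonUnitalCStarAlgebra S := NonUnitalStarSubalgebra.nonUnitalCStarAlgebra S
  let _ := CStarAlgebra.spectralOrder S
  have _ := CStarAlgebra.spectralOrderedRing S
  let _ := CStarAlgebra.spectralOrder A
  have _ := CStarAlgebra.spectralOrderedRing A
  have hunit := CStarAlgebra.increasingApproximateUnit S
  have _ := hunit.neBot
  have hlim := (hunit.tendsto_mul_left ⟨a, ha⟩).eventually (Metric.closedBall_mem_nhds _ hε)
  obtain ⟨e, ⟨he_nonneg, he_norm⟩, hae⟩ :=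
    ((hunit.eventually_nonneg.and hunit.eventually_norm).and hlim).exists
  have h_nonneg : (0 : A) ≤ e := by
    obtain ⟨b, rfl⟩ := CStarAlgebra.nonneg_iff_eq_star_mul_self.mp he_nonneg
    exact star_mul_self_nonneg (b : A)
  have h_le_one : (e : A) ≤ 1 :=
    (CStarAlgebra.norm_le_one_iff_of_nonneg (e : A) h_nonneg).mp he_norm
  refine ⟨e, e.2, (IsSelfAdjoint.of_nonneg h_nonneg).star_eq, ?_, ?_⟩
  · exact (CStarAlgebra.norm_le_one_iff_of_nonneg _ (sub_nonneg.mpr h_le_one)).mpr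
      (sub_le_self _ h_nonneg)
  · rw [mul_sub, mul_one, norm_sub_rev, ← dist_eq_norm]
    exact hae

variable [I.IsTwoSided]

theorem norm_quotient_mk_le (a : A) : ‖Ideal.Quotient.mk I a‖ ≤ ‖a‖ :=
  Submodule.Quotient.norm_mk_le I a

theorem exists_quotient_mk_eq_norm_lt (x : A ⧸ I) {r : ℝ} (hr : ‖x‖ < r) :
    ∃ a, Ideal.Quotient.mk I a = x ∧ ‖a‖ < r := by
  obtain ⟨a, ha, hlt⟩ := Submodule.Quotient.norm_mk_lt x (sub_pos.mpr hr)
  exact ⟨a, ha, by rwa [add_sub_cancel] at hlt⟩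

theorem norm_quotient_mul_le (x y : A ⧸ I) : ‖x * y‖ ≤ ‖x‖ * ‖y‖ := by
  refine le_mul_of_forall_lt₀ fun r hr s hs => ?_
  obtain ⟨a, rfl, ha⟩ := exists_quotient_mk_eq_norm_lt I x hr
  obtain ⟨b, rfl, hb⟩ := exists_quotient_mk_eq_norm_lt I y hs
  calc ‖Ideal.Quotient.mk I a * Ideal.Quotient.mk I b‖ = ‖Ideal.Quotient.mk I (a * b)‖ := by
        rw [map_mul]
    _ ≤ ‖a * b‖ := norm_quotient_mk_le I _
    _ ≤ ‖a‖ * ‖b‖ := norm_mul_le a b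
    _ ≤ r * s := by gcongr; exact (norm_nonneg a).trans ha.le

theorem norm_quotient_mk_le_norm_mul_one_sub (a : A) {e : A} (he : e ∈ I) :
    ‖Ideal.Quotient.mk I a‖ ≤ ‖a * (1 - e)‖ := by
  have heq : Ideal.Quotient.mk I a = Ideal.Quotient.mk I (a * (1 - e)) := by
    rw [Ideal.Quotient.eq, mul_sub, mul_one, sub_sub_cancel]
    exact I.mul_mem_left _ he
  rw [heq]
  exact norm_quotient_mk_le I _

theorem norm_quotient_mk_mul_self_le [IsStarIdeal I] [IsClosed (I : Set A)] (a : A) :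
    ‖Ideal.Quotient.mk I a‖ * ‖Ideal.Quotient.mk I a‖ ≤ ‖Ideal.Quotient.mk I (star a * a)‖ := by
  refine le_of_forall_pos_le_add fun ε hε => ?_
  obtain ⟨b, hb, hb_lt⟩ := exists_quotient_mk_eq_norm_lt I (Ideal.Quotient.mk I (star a * a))
    (lt_add_of_pos_right _ (half_pos hε))
  obtain ⟨e, he, he_star, he_norm, he_small⟩ :=
    exists_mem_ideal_norm_mul_one_sub_le I (Ideal.Quotient.eq.mp hb.symm) (half_pos hε)
  have hsplit : star (a * (1 - e)) * (a * (1 - e)) =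
      (1 - e) * b * (1 - e) + (1 - e) * ((star a * a - b) * (1 - e)) := by
    rw [star_mul, star_sub, star_one, he_star]
    noncomm_ring
  calc ‖Ideal.Quotient.mk I a‖ * ‖Ideal.Quotient.mk I a‖
      ≤ ‖a * (1 - e)‖ * ‖a * (1 - e)‖ :=
        mul_self_le_mul_self (norm_nonneg _) (norm_quotient_mk_le_norm_mul_one_sub I a he)
    _ = ‖(1 - e) * b * (1 - e) + (1 - e) * ((star a * a - b) * (1 - e))‖ := by
        rw [← hsplit, CStarRing.norm_star_mul_self]
    _ ≤ ‖1 - e‖ * ‖b‖ * ‖1 - e‖ + ‖1 - e‖ * ‖(star a * a - b) * (1 - e)‖ := by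
        refine (norm_add_le _ _).trans (add_le_add ((norm_mul_le _ _).trans ?_) (norm_mul_le _ _))
        gcongr
        exact norm_mul_le _ _
    _ ≤ 1 * ‖b‖ * 1 + 1 * (ε / 2) := by gcongr
    _ ≤ ‖Ideal.Quotient.mk I (star a * a)‖ + ε := by linarith

variable [IsStarIdeal I]

instance : StarRing (A ⧸ I) where
  star := Quotient.map' star fun a b hab => by
    rw [Submodule.quotientRel_def] at hab ⊢
    rw [← star_sub]
    exact IsStarIdeal.star_mem _ hab
  star_involutive := by
    rintro ⟨a⟩
    exact congrArg (Ideal.Quotient.mk I) (star_star a)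
  star_mul := by
    rintro ⟨a⟩ ⟨b⟩
    exact congrArg (Ideal.Quotient.mk I) (star_mul a b)
  star_add := by
    rintro ⟨a⟩ ⟨b⟩
    exact congrArg (Ideal.Quotient.mk I) (star_add a b)

/-- The quotient map `A → A / I` as a `*`-homomorphism. -/
def quotientMk : A →⋆ₐ[ℂ] A ⧸ I where
  __ := Ideal.Quotient.mkₐ ℂ I
  map_star' _ := rfl

theorem quotientMk_eq_zero {a : A} : quotientMk I a = 0 ↔ a ∈ I := Ideal.Quotient.eq_zero_iff_mem

theorem quotientMk_surjective : Function.Surjective (quotientMk I) := Ideal.Quotient.mk_surjective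

/-- The `*`-homomorphism `A / I → B` induced by a `*`-homomorphism `A → B` that kills `I`. -/
def quotientLift (f : A →⋆ₐ[ℂ] B) (hf : ∀ a ∈ I, f a = 0) : A ⧸ I →⋆ₐ[ℂ] B where
  __ := Ideal.Quotient.liftₐ I f.toAlgHom hf
  map_star' := by
    rintro ⟨a⟩
    exact map_star f a

theorem quotientLift_mk (f : A →⋆ₐ[ℂ] B) (hf : ∀ a ∈ I, f a = 0) (a : A) :
    quotientLift I f hf (quotientMk I a) = f a := rfl

variable [IsClosed (I : Set A)]

instance : CStarAlgebra (A ⧸ I) where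
  __ := Submodule.Quotient.normedAddCommGroup I
  __ := Ideal.Quotient.ring I
  __ := (inferInstance : Algebra ℂ (A ⧸ I))
  __ := (inferInstance : StarRing (A ⧸ I))
  __ := Submodule.Quotient.completeSpace I
  norm_mul_le := norm_quotient_mul_le I
  norm_smul_le := (Submodule.Quotient.normedSpace I ℂ).norm_smul_le
  star_smul := by
    rintro c ⟨a⟩
    exact congrArg (Ideal.Quotient.mk I) (star_smul c a)
  norm_mul_self_le := by
    rintro ⟨a⟩
    exact norm_quotient_mk_mul_self_le I a

end Quotient

section IdealClosure

variable {A : Type u} [CStarAlgebra A] (I : Ideal A)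

instance : IsClosed (I.closure : Set A) := isClosed_closure

instance [I.IsTwoSided] : I.closure.IsTwoSided where
  mul_mem_of_left b ha :=
    map_mem_closure (f := (· * b)) (continuous_mul_const b) ha fun _ hx => I.mul_mem_right b hx

instance [IsStarIdeal I] : IsStarIdeal I.closure where
  star_mem _ ha := map_mem_closure continuous_star ha IsStarIdeal.star_mem

theorem star_mem_span {R : Type*} [NonUnitalRing R] [StarRing R] {s : Set R}
    (hs : ∀ a ∈ s, star a ∈ s) {a : R} (ha : a ∈ TwoSidedIdeal.span s) :
    star a ∈ TwoSidedIdeal.span s := by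
  induction ha using TwoSidedIdeal.span_induction with
  | mem a ha => exact TwoSidedIdeal.subset_span (hs a ha)
  | zero => rw [star_zero]; exact zero_mem _
  | add a b _ _ ha hb => rw [star_add]; exact add_mem ha hb
  | neg a _ ha => rw [star_neg]; exact neg_mem ha
  | left_absorb b a _ ha => rw [star_mul]; exact TwoSidedIdeal.mul_mem_right _ _ _ ha
  | right_absorb b a _ ha => rw [star_mul]; exact TwoSidedIdeal.mul_mem_left _ _ _ ha

end IdealClosure

/-- A `*`-homomorphism of C*-algebras as a continuous linear map. -/
def homCLM {A B : Type*} [CStarAlgebra A] [CStarAlgebra B] (f : A →⋆ₐ[ℂ] B) : A →L[ℂ] B :=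
  ⟨f.toAlgHom.toLinearMap, SpatialTensor.continuous_hom f⟩

theorem homCLM_apply {A B : Type*} [CStarAlgebra A] [CStarAlgebra B] (f : A →⋆ₐ[ℂ] B) (a : A) :
    homCLM f a = f a := rfl

namespace PosFunctional

variable {A B : Type u} [CStarAlgebra A] [CStarAlgebra B]

@[ext]
theorem ext {φ ψ : PosFunctional A} (h : ∀ a, φ a = ψ a) : φ = ψ := by
  obtain ⟨f, hf⟩ := φ
  obtain ⟨g, hg⟩ := ψ
  obtain rfl : f = g := ContinuousLinearMap.ext h
  rfl

/-- The pullback of a positive functional along a `*`-homomorphism. -/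
def comp (φ : PosFunctional B) (f : A →⋆ₐ[ℂ] B) : PosFunctional A where
  toContinuousLinearMap := φ.toContinuousLinearMap.comp (homCLM f)
  nonneg' a := by
    change 0 ≤ φ (f (star a * a))
    rw [map_mul, map_star]
    exact φ.nonneg' _

theorem comp_apply (φ : PosFunctional B) (f : A →⋆ₐ[ℂ] B) (a : A) : φ.comp f a = φ (f a) := rfl

/-- The multiple of a positive functional by a scalar `r ≥ 0`. -/
def smul (r : ℂ) (hr : 0 ≤ r) (φ : PosFunctional A) : PosFunctional A where
  toContinuousLinearMap := r • φ.toContinuousLinearMap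
  nonneg' a := mul_nonneg hr (φ.nonneg' a)

theorem smul_apply (r : ℂ) (hr : 0 ≤ r) (φ : PosFunctional A) (a : A) :
    φ.smul r hr a = r * φ a := rfl

/-- The sum of a finite family of positive functionals. -/
def sum {ι : Type*} (s : Finset ι) (φ : ι → PosFunctional A) : PosFunctional A where
  toContinuousLinearMap := ∑ i ∈ s, (φ i).toContinuousLinearMap
  nonneg' a := by
    rw [sum_apply]
    exact Finset.sum_nonneg fun i _ => (φ i).nonneg' a

theorem sum_apply {ι : Type*} (s : Finset ι) (φ : ι → PosFunctional A) (a : A) :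
    sum s φ a = ∑ i ∈ s, φ i a :=
  _root_.sum_apply _ _ _

/-- The arithmetic mean of a finite family of positive functionals, `0` for the empty family. -/
def average {ι : Type*} (s : Finset ι) (φ : ι → PosFunctional A) : PosFunctional A :=
  (sum s φ).smul (s.card : ℂ)⁻¹ (inv_nonneg.mpr s.card.cast_nonneg)

theorem average_apply {ι : Type*} (s : Finset ι) (φ : ι → PosFunctional A) (a : A) :
    average s φ a = (s.card : ℂ)⁻¹ * ∑ i ∈ s, φ i a := by
  rw [average, smul_apply, sum_apply]

theorem average_one {ι : Type*} {s : Finset ι} (hs : s.Nonempty) {φ : ι → PosFunctional A}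
    (hφ : ∀ i, φ i 1 = 1) : average s φ 1 = 1 := by
  have hcard : (s.card : ℂ) ≠ 0 := Nat.cast_ne_zero.mpr hs.card_ne_zero
  simp only [average_apply, hφ, Finset.sum_const, nsmul_one, inv_mul_cancel₀ hcard]

theorem apply_star (φ : PosFunctional A) (a : A) : φ (star a) = star (φ a) := by
  obtain ⟨ρ, ξ, hξ⟩ := φ.exists_rep
  rw [hξ, hξ, map_star, ContinuousLinearMap.star_eq_adjoint,
    ContinuousLinearMap.adjoint_inner_right]
  exact (inner_conj_symm _ _).symm

theorem apply_mul_eq_zero (φ : PosFunctional A) {z : A} (hz : φ (star z * z) = 0) (w : A) :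
    φ (w * z) = 0 := by
  obtain ⟨ρ, ξ, hξ⟩ := φ.exists_rep
  have hzξ : ρ.π z ξ = 0 := by
    rw [hξ, map_mul, map_star, mul_apply_eq_comp, ContinuousLinearMap.star_eq_adjoint,
      ContinuousLinearMap.adjoint_inner_right] at hz
    exact inner_self_eq_zero.mp hz
  rw [hξ, map_mul, mul_apply_eq_comp, hzξ, map_zero, inner_zero_right]

theorem apply_one_nonneg (φ : PosFunctional A) : 0 ≤ φ 1 := by
  simpa only [star_one, mul_one] using φ.nonneg' 1

theorem norm_apply_le {φ : PosFunctional A} (hφ : φ 1 = 1) (a : A) : ‖φ a‖ ≤ ‖a‖ := by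
  obtain ⟨ρ, ξ, hξ⟩ := φ.exists_rep
  have hnorm : ‖ξ‖ * ‖ξ‖ = 1 := by
    rw [← SpatialTensor.sq_norm_of_rep hξ, hφ, Complex.one_re]
  calc ‖φ a‖ = ‖⟪ξ, ρ.π a ξ⟫_ℂ‖ := by rw [hξ]
    _ ≤ ‖ξ‖ * ‖ρ.π a ξ‖ := norm_inner_le_norm _ _
    _ ≤ ‖ξ‖ * (‖a‖ * ‖ξ‖) := by
      gcongr
      exact ((ρ.π a).le_opNorm ξ).trans (mul_le_mul_of_nonneg_right (ρ.norm_le a) (norm_nonneg _))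
    _ = ‖a‖ := by rw [mul_left_comm, hnorm, mul_one]

theorem eq_zero_of_forall_state {a : A} (h : ∀ φ : PosFunctional A, φ 1 = 1 → φ a = 0) :
    a = 0 := by
  have hall (φ : PosFunctional A) : φ a = 0 := by
    by_cases hφ : φ 1 = 0
    · have hnull := φ.apply_mul_eq_zero (z := 1) (by rwa [star_one, mul_one]) a
      rwa [mul_one] at hnull
    · have hstate := h (φ.smul (φ 1)⁻¹ (inv_nonneg.mpr φ.apply_one_nonneg)) (inv_mul_cancel₀ hφ)
      exact (mul_eq_zero.mp hstate).resolve_left (inv_ne_zero hφ)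
  obtain ⟨ρ, hρ⟩ := exists_rep_norm a
  have hzero : ρ.π a = 0 := by
    refine ContinuousLinearMap.coe_injective (inner_map_self_eq_zero _ |>.mp fun ξ => ?_)
    rw [← inner_conj_symm]
    exact (congrArg _ (hall (ρ.vec ξ))).trans (map_zero _)
  rwa [hzero, norm_zero, norm_le_zero_iff] at hρ

theorem exists_state (A : Type u) [CStarAlgebra A] [Nontrivial A] :
    ∃ φ : PosFunctional A, φ 1 = 1 := by
  obtain ⟨f, hf_norm, hf⟩ := exists_dual_vector'' ℂ (1 : A)
  have hf_one : f 1 = 1 := by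
    rw [hf, CStarRing.norm_one]
    rfl
  exact ⟨⟨f, nonneg_of_norm_le_one f hf_norm hf_one⟩, hf_one⟩

theorem exists_state_tendsto {ι : Type*} (l : Ultrafilter ι) {φ : ι → PosFunctional A}
    (hφ : ∀ i, φ i 1 = 1) :
    ∃ ψ : PosFunctional A, ψ 1 = 1 ∧ ∀ a, Filter.Tendsto (fun i => φ i a) l (nhds (ψ a)) := by
  let F : ι → WeakDual ℂ A := fun i => StrongDual.toWeakDual (φ i).toContinuousLinearMap
  have hball (i : ι) : F i ∈ WeakDual.toStrongDual ⁻¹' Metric.closedBall 0 1 := by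
    refine mem_closedBall_zero_iff.mpr (ContinuousLinearMap.opNorm_le_bound _ zero_le_one ?_)
    intro a
    rw [one_mul]
    exact norm_apply_le (hφ i) a
  obtain ⟨f, -, hf⟩ := (WeakDual.isCompact_closedBall (0 : StrongDual ℂ A) 1).ultrafilter_le_nhds
    (l.map F) (Filter.le_principal_iff.mpr (Filter.mem_map.mpr (Filter.univ_mem' hball)))
  have hlim (a : A) : Filter.Tendsto (fun i => φ i a) l (nhds (f a)) :=
    ((WeakDual.eval_continuous a).tendsto f).comp hf
  refine ⟨⟨WeakDual.toStrongDual f, fun a => ?_⟩, ?_, hlim⟩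
  · exact ge_of_tendsto' (hlim (star a * a)) fun i => (φ i).nonneg' a
  · exact tendsto_nhds_unique (hlim 1) (tendsto_const_nhds.congr fun i => (hφ i).symm)

theorem tendsto_average_sub_average {p : ℕ → PosFunctional A} (hp : ∀ k, p k 1 = 1) {a b : A}
    (hab : ∀ k, p k b = p (k + 1) a) :
    Filter.Tendsto
      (fun n => average (Finset.range (n + 1)) p b - average (Finset.range (n + 1)) p a)
      Filter.atTop (nhds 0) := by
  have hbdd : Bornology.IsBounded (Set.range fun k => p k a) :=
    isBounded_iff_forall_norm_le.mpr ⟨‖a‖, Set.forall_mem_range.mpr fun k => norm_apply_le (hp k) a⟩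
  refine ((tendsto_birkhoffAverage_apply_sub_birkhoffAverage ℂ (f := Nat.succ) (x := 0)
    (hbdd.subset (Set.range_comp_subset_range _ _))).comp (Filter.tendsto_add_atTop_nat 1)).congr
      fun n => ?_
  simp only [average_apply, hab, Finset.card_range, birkhoffAverage, birkhoffSum, smul_eq_mul,
    Function.comp_apply, Nat.succ_iterate, Nat.succ_eq_add_one, zero_add, add_comm 1]

theorem exists_shift_invariant_mean {p : ℕ → PosFunctional A} (hp : ∀ k, p k 1 = 1) :
    ∃ ψ : PosFunctional A, ψ 1 = 1 ∧ ∀ a b, (∀ k, p k b = p (k + 1) a) → ψ b = ψ a := by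
  obtain ⟨ψ, hψ, hlim⟩ := exists_state_tendsto (Filter.hyperfilter ℕ)
    (φ := fun n => average (Finset.range (n + 1)) p)
    fun n => average_one Finset.nonempty_range_add_one hp
  exact ⟨ψ, hψ, fun a b hab => sub_eq_zero.mp <| tendsto_nhds_unique ((hlim b).sub (hlim a))
    ((tendsto_average_sub_average hp hab).mono_left Nat.hyperfilter_le_atTop)⟩

end PosFunctional

theorem dense_span_image {E F : Type*} [NormedAddCommGroup E] [NormedSpace ℂ E]
    [NormedAddCommGroup F] [NormedSpace ℂ F] {f : E →L[ℂ] F} (hf : DenseRange f) {s : Set E}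
    (hs : Dense (Submodule.span ℂ s : Set E)) : Dense (Submodule.span ℂ (f '' s) : Set F) := by
  have himage := hf.dense_image f.continuous hs
  rwa [← ContinuousLinearMap.coe_coe, ← Submodule.map_coe, Submodule.map_span] at himage

theorem isClosed_range_of_injective {A B : Type*} [CStarAlgebra A] [CStarAlgebra B]
    {f : A →⋆ₐ[ℂ] B} (hf : Function.Injective f) : IsClosed (Set.range f) :=
  (NonUnitalStarAlgHom.isometry f hf).isClosedEmbedding.isClosed_range

namespace SpatialTensor

variable {A B C A' B' C' : Type u} [CStarAlgebra A] [CStarAlgebra B] [CStarAlgebra C]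
  [CStarAlgebra A'] [CStarAlgebra B'] [CStarAlgebra C']

section Ext

variable {F : Type*} [NormedAddCommGroup F] [NormedSpace ℂ F]

theorem clm_ext {f g : SpatialTensor A B →L[ℂ] F} (h : ∀ a b, f (tmul a b) = g (tmul a b)) :
    f = g := by
  ext x
  exact induction_tmul x (p := fun x => f x = g x) (isClosed_eq f.continuous g.continuous)
    (by rw [map_zero, map_zero]) (fun x y hx hy => by rw [map_add, map_add, hx, hy]) h

/-- The map `a ↦ a ⊗ b`. -/
def tmulRightCLM (A : Type u) [CStarAlgebra A] (b : B) : A →L[ℂ] SpatialTensor A B :=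
  LinearMap.mkContinuous
    { toFun := fun a => tmul a b
      map_add' := fun a a' => add_tmul a a' b
      map_smul' := fun c a => smul_tmul c a b } ‖b‖
    fun a => (norm_tmul_le a b).trans_eq (mul_comm _ _)

theorem clm_ext₃ {f g : SpatialTensor (SpatialTensor A B) C →L[ℂ] F}
    (h : ∀ a b c, f (tmul (tmul a b) c) = g (tmul (tmul a b) c)) : f = g :=
  clm_ext fun x c => DFunLike.congr_fun (clm_ext (f := f.comp (tmulRightCLM _ c))
    (g := g.comp (tmulRightCLM _ c)) fun a b => h a b c) x

theorem hom_ext {E : Type*} [CStarAlgebra E] {f g : SpatialTensor A B →⋆ₐ[ℂ] E}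
    (h : ∀ a b, f (tmul a b) = g (tmul a b)) : f = g :=
  StarAlgHom.ext fun x =>
    DFunLike.congr_fun (clm_ext (f := homCLM f) (g := homCLM g) h : homCLM f = homCLM g) x

theorem hom_ext₃ {E : Type*} [CStarAlgebra E]
    {f g : SpatialTensor (SpatialTensor A B) C →⋆ₐ[ℂ] E}
    (h : ∀ a b c, f (tmul (tmul a b) c) = g (tmul (tmul a b) c)) : f = g :=
  StarAlgHom.ext fun x =>
    DFunLike.congr_fun (clm_ext₃ (f := homCLM f) (g := homCLM g) h : homCLM f = homCLM g) x

end Ext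

theorem map_id_id : map (StarAlgHom.id ℂ A) (StarAlgHom.id ℂ B) = StarAlgHom.id ℂ _ :=
  hom_ext (map_tmul _ _)

theorem map_comp_map (f' : A' →⋆ₐ[ℂ] C) (f : A →⋆ₐ[ℂ] A') (g' : B' →⋆ₐ[ℂ] C')
    (g : B →⋆ₐ[ℂ] B') : (map f' g').comp (map f g) = map (f'.comp f) (g'.comp g) :=
  hom_ext fun a b => by simp only [StarAlgHom.comp_apply, map_tmul]

theorem map_map (f' : A' →⋆ₐ[ℂ] C) (f : A →⋆ₐ[ℂ] A') (g' : B' →⋆ₐ[ℂ] C') (g : B →⋆ₐ[ℂ] B')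
    (x : SpatialTensor A B) : map f' g' (map f g x) = map (f'.comp f) (g'.comp g) x :=
  DFunLike.congr_fun (map_comp_map f' f g' g) x

theorem assoc_map (f : A →⋆ₐ[ℂ] A') (g : B →⋆ₐ[ℂ] B') (k : C →⋆ₐ[ℂ] C')
    (x : SpatialTensor (SpatialTensor A B) C) :
    assoc (map (map f g) k x) = map f (map g k) (assoc x) :=
  DFunLike.congr_fun (hom_ext₃ (f := assoc.comp (map (map f g) k))
    (g := (map f (map g k)).comp assoc) fun a b c => by
      simp only [StarAlgHom.comp_apply, map_tmul, assoc_tmul]) x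

theorem denseRange_map {f : A →⋆ₐ[ℂ] A'} {g : B →⋆ₐ[ℂ] B'} (hf : Function.Surjective f)
    (hg : Function.Surjective g) : DenseRange (map f g) := by
  intro x
  refine induction_tmul x (p := fun x => x ∈ closure (Set.range (map f g))) isClosed_closure
    (subset_closure ⟨0, map_zero _⟩) (fun x y hx hy => ?_) fun a b => ?_
  · exact (homCLM (map f g)).range.topologicalClosure.add_mem hx hy
  · obtain ⟨a, rfl⟩ := hf a
    obtain ⟨b, rfl⟩ := hg b
    exact subset_closure ⟨tmul a b, map_tmul f g a b⟩

section Slice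

theorem leftSlice_map (φ : PosFunctional A') (f : A →⋆ₐ[ℂ] A') (g : B →⋆ₐ[ℂ] B')
    (x : SpatialTensor A B) : leftSlice φ (map f g x) = g (leftSlice (φ.comp f) x) :=
  DFunLike.congr_fun (clm_ext (f := (leftSlice φ).comp (homCLM (map f g)))
    (g := (homCLM g).comp (leftSlice (φ.comp f))) fun a b => by
      simp only [ContinuousLinearMap.comp_apply, homCLM_apply, map_tmul, leftSlice_tmul, map_smul,
        PosFunctional.comp_apply]) x

theorem rightSlice_map (ψ : PosFunctional B') (f : A →⋆ₐ[ℂ] A') (g : B →⋆ₐ[ℂ] B')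
    (x : SpatialTensor A B) : rightSlice ψ (map f g x) = f (rightSlice (ψ.comp g) x) :=
  DFunLike.congr_fun (clm_ext (f := (rightSlice ψ).comp (homCLM (map f g)))
    (g := (homCLM f).comp (rightSlice (ψ.comp g))) fun a b => by
      simp only [ContinuousLinearMap.comp_apply, homCLM_apply, map_tmul, rightSlice_tmul, map_smul,
        PosFunctional.comp_apply]) x

theorem apply_leftSlice_eq_apply_rightSlice (φ : PosFunctional A) (ψ : PosFunctional B)
    (x : SpatialTensor A B) : ψ (leftSlice φ x) = φ (rightSlice ψ x) :=
  DFunLike.congr_fun (clm_ext (f := ψ.toContinuousLinearMap.comp (leftSlice φ))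
    (g := φ.toContinuousLinearMap.comp (rightSlice ψ)) fun a b => by
      simp only [ContinuousLinearMap.comp_apply, leftSlice_tmul, rightSlice_tmul, map_smul,
        smul_eq_mul, mul_comm]) x

theorem ext_leftSlice {x y : SpatialTensor A B}
    (h : ∀ φ : PosFunctional A, leftSlice φ x = leftSlice φ y) : x = y :=
  sub_eq_zero.mp (eq_zero_of_slices _ fun φ ψ => by rw [map_sub, h, sub_self, map_zero])

theorem ext_rightSlice {x y : SpatialTensor A B}
    (h : ∀ ψ : PosFunctional B, rightSlice ψ x = rightSlice ψ y) : x = y :=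
  sub_eq_zero.mp (eq_zero_of_slices _ fun φ ψ => by
    rw [apply_leftSlice_eq_apply_rightSlice, map_sub, h, sub_self, map_zero])

theorem map_id_injective {f : A →⋆ₐ[ℂ] A'} (hf : Function.Injective f) :
    Function.Injective (map f (StarAlgHom.id ℂ B)) := fun x y hxy =>
  ext_rightSlice fun ψ => hf (by
    have hslice := congrArg (rightSlice ψ) hxy
    rwa [rightSlice_map, rightSlice_map] at hslice)

theorem leftSlice_rightSlice (φ : PosFunctional A) (ψ : PosFunctional C)
    (x : SpatialTensor (SpatialTensor A B) C) :
    leftSlice φ (rightSlice ψ x) = rightSlice ψ (leftSlice φ (assoc x)) :=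
  DFunLike.congr_fun (clm_ext₃ (f := (leftSlice φ).comp (rightSlice ψ))
    (g := (rightSlice ψ).comp ((leftSlice φ).comp (homCLM assoc))) fun a b c => by
      simp only [ContinuousLinearMap.comp_apply, homCLM_apply, assoc_tmul, leftSlice_tmul,
        rightSlice_tmul, map_smul]
      exact smul_comm _ _ _) x

theorem leftSlice_assoc_tmul (φ : PosFunctional A) (x : SpatialTensor A B) (c : C) :
    leftSlice φ (assoc (tmul x c)) = tmul (leftSlice φ x) c :=
  DFunLike.congr_fun (clm_ext
    (f := ((leftSlice φ).comp (homCLM assoc)).comp (tmulRightCLM _ c))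
    (g := (tmulRightCLM _ c).comp (leftSlice φ)) fun a b => by
      change leftSlice φ (assoc (tmul (tmul a b) c)) = tmul (leftSlice φ (tmul a b)) c
      simp only [assoc_tmul, leftSlice_tmul, smul_tmul]) x

theorem charSlice_assoc (χ : A →⋆ₐ[ℂ] ℂ) (x : SpatialTensor (SpatialTensor A B) C) :
    charSlice χ (assoc x) = map (charSlice χ) (StarAlgHom.id ℂ C) x :=
  DFunLike.congr_fun (hom_ext₃ (f := (charSlice χ).comp assoc)
    (g := map (charSlice χ) (StarAlgHom.id ℂ C)) fun a b c => by
      simp only [StarAlgHom.comp_apply, assoc_tmul, map_tmul, charSlice_tmul, smul_tmul,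
        StarAlgHom.coe_id, id_eq]) x

theorem leftSlice_one_tmul_mul (φ : PosFunctional A) (b : B) (x : SpatialTensor A B) :
    leftSlice φ (tmul 1 b * x) = b * leftSlice φ x :=
  DFunLike.congr_fun (clm_ext
    (f := (leftSlice φ).comp (ContinuousLinearMap.mul ℂ (SpatialTensor A B) (tmul 1 b)))
    (g := (ContinuousLinearMap.mul ℂ B b).comp (leftSlice φ)) fun a c => by
      simp only [ContinuousLinearMap.comp_apply, ContinuousLinearMap.mul_apply', tmul_mul_tmul,
        leftSlice_tmul, one_mul, mul_smul_comm]) x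

theorem leftSlice_star (φ : PosFunctional A) (x : SpatialTensor A B) :
    leftSlice φ (star x) = star (leftSlice φ x) := by
  refine induction_tmul x (p := fun x => leftSlice φ (star x) = star (leftSlice φ x))
    (isClosed_eq (by fun_prop) (by fun_prop)) (by simp only [star_zero, map_zero])
    (fun x y hx hy => by rw [star_add, map_add, map_add, star_add, hx, hy]) fun a b => ?_
  rw [star_tmul, leftSlice_tmul, leftSlice_tmul, star_smul, φ.apply_star]

theorem leftSlice_mul_one_tmul (φ : PosFunctional A) (b : B) (x : SpatialTensor A B) :
    leftSlice φ (x * tmul 1 b) = leftSlice φ x * b := by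
  have hstar : x * tmul 1 b = star (tmul 1 (star b) * star x) := by
    rw [star_mul, star_star, star_tmul, star_one, star_star]
  rw [hstar, leftSlice_star, leftSlice_one_tmul_mul, leftSlice_star, star_mul, star_star, star_star]

/-- The positive functional `φ ⊗ ψ` on the spatial tensor product, written as `ψ ∘ (φ ⊗ ι)`. -/
def prodFunctional (φ : PosFunctional A) (ψ : PosFunctional B) :
    PosFunctional (SpatialTensor A B) where
  toContinuousLinearMap := ψ.toContinuousLinearMap.comp (leftSlice φ)
  nonneg' x := by
    obtain ⟨ρ, ξ, hξ⟩ := φ.exists_rep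
    obtain ⟨σ, η, hη⟩ := ψ.exists_rep
    let τ : Rep (SpatialTensor A B) := ⟨HilbertTensor ρ.H σ.H, rep ρ σ⟩
    let ζ : τ.H := HilbertTensor.of (ξ ⊗ₜ[ℂ] η)
    have hvec : ψ.toContinuousLinearMap.comp (leftSlice φ) = (τ.vec ζ).toContinuousLinearMap :=
      clm_ext fun a b => by
        change ψ (leftSlice φ (tmul a b)) = ⟪HilbertTensor.of (ξ ⊗ₜ[ℂ] η),
          rep ρ σ (tmul a b) (HilbertTensor.of (ξ ⊗ₜ[ℂ] η))⟫_ℂ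
        rw [rep_tmul, leftSlice_tmul, opTensor_of, LinearIsometry.inner_map_map,
          TensorProduct.mapL_tmul, TensorProduct.inner_tmul, map_smul, smul_eq_mul, hξ, hη]
    rw [hvec]
    exact (τ.vec ζ).nonneg' x

theorem prodFunctional_apply (φ : PosFunctional A) (ψ : PosFunctional B)
    (x : SpatialTensor A B) : prodFunctional φ ψ x = ψ (leftSlice φ x) := rfl

theorem prodFunctional_apply' (φ : PosFunctional A) (ψ : PosFunctional B)
    (x : SpatialTensor A B) : prodFunctional φ ψ x = φ (rightSlice ψ x) :=
  apply_leftSlice_eq_apply_rightSlice φ ψ x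

theorem eq_zero_of_rightSlice_star_mul_self {ψ : PosFunctional B} (hψ : ψ.IsFaithful)
    {x : SpatialTensor A B} (hx : rightSlice ψ (star x * x) = 0) : x = 0 := by
  refine ext_leftSlice fun φ => ?_
  rw [map_zero]
  refine hψ _ ?_
  have hnull : prodFunctional φ ψ (star x * x) = 0 := by
    rw [prodFunctional_apply', hx, map_zero]
  rw [← leftSlice_one_tmul_mul, ← prodFunctional_apply]
  exact (prodFunctional φ ψ).apply_mul_eq_zero hnull _

end Slice

end SpatialTensor

namespace CompactQuantumGroup

open SpatialTensor

variable {A : Type u} [CStarAlgebra A] (G : CompactQuantumGroup A)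

/-- The convolution operator `(φ ⊗ ι) ∘ Δ` of a positive functional `φ`. -/
def convOp (φ : PosFunctional A) : A →L[ℂ] A := (leftSlice φ).comp (homCLM G.Δ)

theorem convOp_apply (φ : PosFunctional A) (a : A) : G.convOp φ a = leftSlice φ (G.Δ a) := rfl

/-- The convolution `(φ ⊗ ψ) ∘ Δ` of two positive functionals. -/
def conv (φ ψ : PosFunctional A) : PosFunctional A := (prodFunctional φ ψ).comp G.Δ

theorem conv_apply (φ ψ : PosFunctional A) (a : A) : G.conv φ ψ a = ψ (G.convOp φ a) := rfl

theorem conv_apply' (φ ψ : PosFunctional A) (a : A) :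
    G.conv φ ψ a = φ (rightSlice ψ (G.Δ a)) :=
  prodFunctional_apply' φ ψ _

theorem convOp_one {φ : PosFunctional A} (hφ : φ 1 = 1) : G.convOp φ 1 = 1 := by
  rw [convOp_apply, map_one, one_eq_tmul, leftSlice_tmul, hφ, one_smul]

theorem conv_one {φ ψ : PosFunctional A} (hφ : φ 1 = 1) (hψ : ψ 1 = 1) : G.conv φ ψ 1 = 1 := by
  rw [conv_apply, G.convOp_one hφ, hψ]

/-- The operator `convOp φ ⊗ ι`, written as `(φ ⊗ ι ⊗ ι) ∘ (Δ ⊗ ι)` because the spatial tensor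
product is set up to be functorial only in `*`-homomorphisms. -/
def convOpTensor (φ : PosFunctional A) : SpatialTensor A A →L[ℂ] SpatialTensor A A :=
  (leftSlice φ).comp (homCLM (assoc.comp (map G.Δ (StarAlgHom.id ℂ A))))

theorem convOpTensor_tmul (φ : PosFunctional A) (a b : A) :
    G.convOpTensor φ (tmul a b) = tmul (G.convOp φ a) b := by
  change leftSlice φ (assoc (map G.Δ (StarAlgHom.id ℂ A) (tmul a b))) = _
  rw [map_tmul, leftSlice_assoc_tmul]
  rfl

theorem comul_convOp (φ : PosFunctional A) (a : A) :
    G.Δ (G.convOp φ a) = G.convOpTensor φ (G.Δ a) := by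
  change G.Δ (leftSlice φ (G.Δ a)) = leftSlice φ (assoc (map G.Δ (StarAlgHom.id ℂ A) (G.Δ a)))
  rw [G.coassoc, leftSlice_map]
  rfl

theorem leftSlice_convOpTensor (φ ψ : PosFunctional A) (x : SpatialTensor A A) :
    leftSlice ψ (G.convOpTensor φ x) = leftSlice (G.conv φ ψ) x :=
  DFunLike.congr_fun (clm_ext (f := (leftSlice ψ).comp (G.convOpTensor φ))
    (g := leftSlice (G.conv φ ψ)) fun a b => by
      rw [ContinuousLinearMap.comp_apply, convOpTensor_tmul, leftSlice_tmul, leftSlice_tmul,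
        conv_apply]) x

theorem convOp_convOp (φ ψ : PosFunctional A) (a : A) :
    G.convOp ψ (G.convOp φ a) = G.convOp (G.conv φ ψ) a := by
  rw [convOp_apply, comul_convOp, leftSlice_convOpTensor, convOp_apply]

theorem conv_assoc (φ ψ ω : PosFunctional A) :
    G.conv (G.conv φ ψ) ω = G.conv φ (G.conv ψ ω) := by
  ext a
  rw [conv_apply, ← convOp_convOp, conv_apply, conv_apply]

theorem exists_absorbing_state {ω : PosFunctional A} (hω : ω 1 = 1) :
    ∃ h : PosFunctional A, h 1 = 1 ∧ G.conv h ω = h ∧ G.conv ω h = h := by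
  let p (n : ℕ) : PosFunctional A := n.rec ω fun _ φ => G.conv φ ω
  have hp_right (n : ℕ) : p (n + 1) = G.conv (p n) ω := rfl
  have hp_left (n : ℕ) : p (n + 1) = G.conv ω (p n) := by
    induction n with
    | zero => rfl
    | succ n ih => exact (congrArg (G.conv · ω) ih).trans (G.conv_assoc ω (p n) ω)
  have hp_one (n : ℕ) : p n 1 = 1 := by
    induction n with
    | zero => exact hω
    | succ n ih => rw [hp_right, G.conv_one ih hω]
  obtain ⟨h, h_one, h_shift⟩ := PosFunctional.exists_shift_invariant_mean hp_one
  refine ⟨h, h_one, PosFunctional.ext fun a => ?_, PosFunctional.ext fun a => ?_⟩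
  · rw [conv_apply']
    exact h_shift a _ fun k => by rw [hp_right, conv_apply']
  · rw [conv_apply]
    exact h_shift a _ fun k => by rw [hp_left, conv_apply]

theorem prodFunctional_comul_sub_eq_zero {ω h : PosFunctional A} (hω : ω 1 = 1)
    (habs : G.conv ω h = h) {y : A} (hy : G.convOp ω y = y) :
    prodFunctional ω h (star (G.Δ y - tmul 1 y) * (G.Δ y - tmul 1 y)) = 0 := by
  have hexpand : star (G.Δ y - tmul 1 y) * (G.Δ y - tmul 1 y) =
      G.Δ (star y * y) - star (G.Δ y) * tmul 1 y - tmul 1 (star y) * G.Δ y +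
        tmul 1 (star y * y) := by
    have hmul : tmul (1 : A) (star y * y) = tmul 1 (star y) * tmul 1 y := by
      rw [tmul_mul_tmul, one_mul]
    rw [star_sub, star_tmul, star_one, hmul, map_mul, map_star]
    noncomm_ring
  have hslice : leftSlice ω (G.Δ y) = y := hy
  rw [prodFunctional_apply, hexpand, map_add, map_sub, map_sub, leftSlice_mul_one_tmul,
    leftSlice_one_tmul_mul, leftSlice_star, hslice, leftSlice_tmul, hω, one_smul,
    sub_add_cancel, map_sub, ← convOp_apply, ← conv_apply, habs, sub_self]

theorem apply_mul_convOp_of_dominated {ω h ρ ρ' : PosFunctional A} (hω : ω 1 = 1) (hρ : ρ 1 = 1)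
    (habs : G.conv ω h = h) {N : ℂ} (hdom : ∀ a, ρ a + ρ' a = N * ω a) {y : A}
    (hy : G.convOp ω y = y) (c : A) : h (c * G.convOp ρ y) = h (c * y) := by
  set z := G.Δ y - tmul 1 y with hz
  have hsum : prodFunctional ρ h (star z * z) + prodFunctional ρ' h (star z * z) = 0 := by
    simp only [prodFunctional_apply']
    rw [hdom, ← prodFunctional_apply', G.prodFunctional_comul_sub_eq_zero hω habs hy, mul_zero]
  have hnull : prodFunctional ρ h (star z * z) = 0 :=
    ((add_eq_zero_iff_of_nonneg ((prodFunctional ρ h).nonneg' z)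
      ((prodFunctional ρ' h).nonneg' z)).mp hsum).1
  have hz_zero := (prodFunctional ρ h).apply_mul_eq_zero hnull (tmul 1 c)
  rwa [prodFunctional_apply, leftSlice_one_tmul_mul, hz, map_sub, leftSlice_tmul, hρ, one_smul,
    mul_sub, map_sub, sub_eq_zero] at hz_zero

theorem eq_of_forall_apply_mul_convOp {h φ ψ : PosFunctional A} (h_one : h 1 = 1)
    (heq : ∀ c a, h (c * G.convOp φ a) = h (c * G.convOp ψ a)) : φ = ψ := by
  have hslice : h.toContinuousLinearMap.comp (leftSlice φ) =
      h.toContinuousLinearMap.comp (leftSlice ψ) := by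
    refine ContinuousLinearMap.ext_on G.dense_right ?_
    rintro _ ⟨c, a, rfl⟩
    change h (leftSlice φ _) = h (leftSlice ψ _)
    rw [leftSlice_one_tmul_mul, leftSlice_one_tmul_mul]
    exact heq c a
  ext b
  have hb : h (leftSlice φ (tmul b 1)) = h (leftSlice ψ (tmul b 1)) :=
    DFunLike.congr_fun hslice (tmul b 1)
  simpa only [leftSlice_tmul, map_smul, h_one, smul_eq_mul, mul_one] using hb

theorem conv_eq_self_of_dominated {ω h ρ ρ' : PosFunctional A} (hω : ω 1 = 1) (hρ : ρ 1 = 1)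
    (h_one : h 1 = 1) (habs_right : G.conv h ω = h) (habs_left : G.conv ω h = h) {N : ℂ}
    (hdom : ∀ a, ρ a + ρ' a = N * ω a) : G.conv h ρ = h :=
  G.eq_of_forall_apply_mul_convOp h_one fun c a => by
    rw [← convOp_convOp]
    exact G.apply_mul_convOp_of_dominated hω hρ habs_left hdom
      (by rw [convOp_convOp, habs_right]) c

theorem exists_state_conv_eq_self [Nontrivial A] {ι : Type*} (s : Finset ι)
    {ρ : ι → PosFunctional A} (hρ : ∀ i, ρ i 1 = 1) :
    ∃ h : PosFunctional A, h 1 = 1 ∧ ∀ i ∈ s, G.conv h (ρ i) = h := by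
  classical
  rcases s.eq_empty_or_nonempty with rfl | hs
  · obtain ⟨h, h_one⟩ := PosFunctional.exists_state A
    exact ⟨h, h_one, fun i hi => absurd hi (Finset.notMem_empty i)⟩
  have hω : PosFunctional.average s ρ 1 = 1 := PosFunctional.average_one hs hρ
  obtain ⟨h, h_one, habs_right, habs_left⟩ := G.exists_absorbing_state hω
  refine ⟨h, h_one, fun i hi => G.conv_eq_self_of_dominated
    (ρ' := PosFunctional.sum (s.erase i) ρ) (N := s.card) hω (hρ i) h_one habs_right habs_left
    fun a => ?_⟩
  rw [PosFunctional.sum_apply, Finset.add_sum_erase s (fun j => ρ j a) hi,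
    PosFunctional.average_apply, mul_inv_cancel_left₀ (Nat.cast_ne_zero.mpr hs.card_ne_zero)]

theorem exists_leftInvariant_state [Nontrivial A] :
    ∃ h : PosFunctional A, h 1 = 1 ∧ ∀ a, G.convOp h a = h a • (1 : A) := by
  choose k hk_one hk using fun s : Finset {ρ : PosFunctional A // ρ 1 = 1} =>
    G.exists_state_conv_eq_self s fun ρ => ρ.2
  obtain ⟨h, h_one, hlim⟩ :=
    PosFunctional.exists_state_tendsto (Ultrafilter.of Filter.atTop) hk_one
  refine ⟨h, h_one, fun a => sub_eq_zero.mp (PosFunctional.eq_zero_of_forall_state fun ρ hρ => ?_)⟩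
  have hconv : h (rightSlice ρ (G.Δ a)) = h a := by
    refine tendsto_nhds_unique (hlim _) ((hlim a).congr' (Ultrafilter.of_le _ ?_))
    filter_upwards [Filter.eventually_ge_atTop {⟨ρ, hρ⟩}] with s hs
    have hmem : (⟨ρ, hρ⟩ : {ρ : PosFunctional A // ρ 1 = 1}) ∈ s :=
      hs (Finset.mem_singleton_self _)
    rw [← conv_apply', hk s _ hmem]
  rw [map_sub, ← conv_apply, conv_apply', hconv, map_smul, hρ, smul_eq_mul, mul_one, sub_self]

end CompactQuantumGroup

namespace QuantumSubgroup

open SpatialTensor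

variable {A : Type u} [CStarAlgebra A] {G : CompactQuantumGroup A}

section Coproduct

variable (K : QuantumSubgroup G)

theorem map_comp_comul : (map K.π K.π).comp G.Δ = K.Δ'.comp K.π :=
  StarAlgHom.ext K.compat

theorem coassoc (b : K.carrier) :
    assoc (map K.Δ' (StarAlgHom.id ℂ K.carrier) (K.Δ' b)) =
      map (StarAlgHom.id ℂ K.carrier) K.Δ' (K.Δ' b) := by
  obtain ⟨a, rfl⟩ := K.surjective b
  calc assoc (map K.Δ' (StarAlgHom.id ℂ K.carrier) (K.Δ' (K.π a)))
    _ = assoc (map (map K.π K.π) K.π (map G.Δ (StarAlgHom.id ℂ A) (G.Δ a))) := by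
      rw [← K.compat, map_map, map_map, K.map_comp_comul]
      rfl
    _ = map K.π (map K.π K.π) (map (StarAlgHom.id ℂ A) G.Δ (G.Δ a)) := by
      rw [assoc_map, G.coassoc]
    _ = map (StarAlgHom.id ℂ K.carrier) K.Δ' (K.Δ' (K.π a)) := by
      rw [← K.compat, map_map, map_map, K.map_comp_comul]
      rfl

theorem dense_span_map_image {s : Set (SpatialTensor A A)}
    (hs : Dense (Submodule.span ℂ s : Set (SpatialTensor A A))) :
    Dense (Submodule.span ℂ (map K.π K.π '' s) : Set (SpatialTensor K.carrier K.carrier)) :=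
  dense_span_image (f := homCLM (map K.π K.π)) (denseRange_map K.surjective K.surjective) hs

/-- The carrier of a quantum subgroup is a compact quantum group in its own right. -/
def toCompactQuantumGroup : CompactQuantumGroup K.carrier where
  Δ := K.Δ'
  coassoc := K.coassoc
  dense_left := (K.dense_span_map_image G.dense_left).mono <| Submodule.span_mono <| by
    rintro _ ⟨_, ⟨b, c, rfl⟩, rfl⟩
    exact ⟨K.π b, K.π c, by rw [map_mul, map_tmul, map_one, K.compat]⟩
  dense_right := (K.dense_span_map_image G.dense_right).mono <| Submodule.span_mono <| by
    rintro _ ⟨_, ⟨b, c, rfl⟩, rfl⟩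
    exact ⟨K.π b, K.π c, by rw [map_mul, map_tmul, map_one, K.compat]⟩

end Coproduct

section Averaging

variable {K : QuantumSubgroup G} {h : PosFunctional K.carrier}

theorem π_convOp (hinv : ∀ b, K.toCompactQuantumGroup.convOp h b = h b • (1 : K.carrier)) (a : A) :
    K.π (G.convOp (h.comp K.π) a) = h (K.π a) • (1 : K.carrier) := by
  rw [← hinv, CompactQuantumGroup.convOp_apply, CompactQuantumGroup.convOp_apply, ← leftSlice_map]
  exact congrArg (leftSlice h) (K.compat a)

theorem map_π_convOpTensor
    (hinv : ∀ b, K.toCompactQuantumGroup.convOp h b = h b • (1 : K.carrier))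
    (x : SpatialTensor A A) :
    map K.π (StarAlgHom.id ℂ A) (G.convOpTensor (h.comp K.π) x) =
      tmul 1 (leftSlice (h.comp K.π) x) :=
  DFunLike.congr_fun (clm_ext
    (f := (homCLM (map K.π (StarAlgHom.id ℂ A))).comp (G.convOpTensor (h.comp K.π)))
    (g := (homCLM (inclRight K.carrier A)).comp (leftSlice (h.comp K.π))) fun a b => by
      change map K.π (StarAlgHom.id ℂ A) (G.convOpTensor (h.comp K.π) (tmul a b)) =
        tmul 1 (leftSlice (h.comp K.π) (tmul a b))
      rw [CompactQuantumGroup.convOpTensor_tmul, map_tmul, π_convOp hinv, leftSlice_tmul,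
        tmul_smul, smul_tmul]
      rfl) x

theorem convOp_mem_rightCoset
    (hinv : ∀ b, K.toCompactQuantumGroup.convOp h b = h b • (1 : K.carrier)) (a : A) :
    G.convOp (h.comp K.π) a ∈ K.rightCoset := by
  rw [mem_rightCoset, G.comul_convOp, map_π_convOpTensor hinv]
  rfl

theorem convOp_eq_self (h_one : h 1 = 1) {a : A} (ha : a ∈ K.rightCoset) :
    G.convOp (h.comp K.π) a = a := by
  have hslice := leftSlice_map h K.π (StarAlgHom.id ℂ A) (G.Δ a)
  rw [(K.mem_rightCoset a).mp ha, leftSlice_tmul, h_one, one_smul] at hslice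
  exact hslice.symm

end Averaging

section QuotientAction

variable (K : QuantumSubgroup G)

/-- The inclusion `A^K ⊗ A → A ⊗ A`. -/
def cosetInclusion : SpatialTensor K.rightCoset A →⋆ₐ[ℂ] SpatialTensor A A :=
  map K.rightCoset.subtype (StarAlgHom.id ℂ A)

theorem cosetInclusion_injective : Function.Injective K.cosetInclusion :=
  map_id_injective Subtype.val_injective

theorem mem_range_cosetInclusion {E : SpatialTensor A A →L[ℂ] SpatialTensor A A}
    (hE : ∀ a b, ∃ a' ∈ K.rightCoset, E (tmul a b) = tmul a' b) (x : SpatialTensor A A) :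
    E x ∈ Set.range K.cosetInclusion := by
  have hclosed : IsClosed (Set.range K.cosetInclusion) :=
    isClosed_range_of_injective K.cosetInclusion_injective
  refine induction_tmul x (p := fun x => E x ∈ Set.range K.cosetInclusion)
    (hclosed.preimage E.continuous) ⟨0, by rw [map_zero, map_zero]⟩ ?_ fun a b => ?_
  · rintro x y ⟨u, hu⟩ ⟨v, hv⟩
    exact ⟨u + v, by rw [map_add, map_add, hu, hv]⟩
  · obtain ⟨a', ha', hab⟩ := hE a b
    exact ⟨tmul ⟨a', ha'⟩ b, (map_tmul _ _ _ _).trans hab.symm⟩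

theorem mem_rightCoset_of_subsingleton [Subsingleton K.carrier] (a : A) : a ∈ K.rightCoset := by
  have hsub : Subsingleton (SpatialTensor K.carrier A) := by
    refine subsingleton_of_zero_eq_one ?_
    rw [one_eq_tmul, Subsingleton.elim (1 : K.carrier) ((0 : ℂ) • 1), smul_tmul, zero_smul]
  exact (K.mem_rightCoset a).mpr (Subsingleton.elim _ _)

theorem comul_mem_range_cosetInclusion (x : K.rightCoset) :
    G.Δ x ∈ Set.range K.cosetInclusion := by
  rcases subsingleton_or_nontrivial K.carrier with hK | hK
  · exact K.mem_range_cosetInclusion (E := ContinuousLinearMap.id ℂ _)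
      (fun a b => ⟨a, K.mem_rightCoset_of_subsingleton a, rfl⟩) (G.Δ x)
  · obtain ⟨h, h_one, hinv⟩ := K.toCompactQuantumGroup.exists_leftInvariant_state
    have hx : G.convOpTensor (h.comp K.π) (G.Δ x) = G.Δ x := by
      rw [← G.comul_convOp, convOp_eq_self h_one x.2]
    rw [← hx]
    exact K.mem_range_cosetInclusion
      (fun a b => ⟨_, convOp_mem_rightCoset hinv a, G.convOpTensor_tmul _ a b⟩) (G.Δ x)

/-- The coproduct of `G` as a map `A^K → A^K ⊗ A`. -/
def cosetComul : K.rightCoset →⋆ₐ[ℂ] SpatialTensor K.rightCoset A :=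
  (StarAlgHomClass.toStarAlgHom
    (StarAlgEquiv.ofInjective K.cosetInclusion K.cosetInclusion_injective).symm).comp
    ((G.Δ.comp K.rightCoset.subtype).codRestrict K.cosetInclusion.range
      K.comul_mem_range_cosetInclusion)

theorem cosetInclusion_cosetComul (x : K.rightCoset) :
    K.cosetInclusion (K.cosetComul x) = G.Δ x :=
  congrArg Subtype.val ((StarAlgEquiv.ofInjective K.cosetInclusion
    K.cosetInclusion_injective).apply_symm_apply ⟨G.Δ x, K.comul_mem_range_cosetInclusion x⟩)

theorem map_subtype_cosetComul {D : Type u} [CStarAlgebra D] (g : A →⋆ₐ[ℂ] D) (x : K.rightCoset) :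
    map K.rightCoset.subtype g (K.cosetComul x) = map (StarAlgHom.id ℂ A) g (G.Δ x) := by
  rw [← K.cosetInclusion_cosetComul, cosetInclusion, map_map]
  rfl

theorem map_subtype_assoc_map_cosetComul (x : K.rightCoset) :
    map K.rightCoset.subtype (StarAlgHom.id ℂ (SpatialTensor A A))
        (assoc (map K.cosetComul (StarAlgHom.id ℂ A) (K.cosetComul x))) =
      assoc (map G.Δ (StarAlgHom.id ℂ A) (G.Δ x)) := by
  have hcomul : K.cosetInclusion.comp K.cosetComul = G.Δ.comp K.rightCoset.subtype :=
    StarAlgHom.ext K.cosetInclusion_cosetComul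
  calc map K.rightCoset.subtype (StarAlgHom.id ℂ (SpatialTensor A A))
        (assoc (map K.cosetComul (StarAlgHom.id ℂ A) (K.cosetComul x)))
    _ = assoc (map K.cosetInclusion (StarAlgHom.id ℂ A)
          (map K.cosetComul (StarAlgHom.id ℂ A) (K.cosetComul x))) := by
      rw [← map_id_id, ← assoc_map]
      rfl
    _ = assoc (map G.Δ (StarAlgHom.id ℂ A) (K.cosetInclusion (K.cosetComul x))) := by
      rw [map_map, hcomul, cosetInclusion, map_map]
    _ = assoc (map G.Δ (StarAlgHom.id ℂ A) (G.Δ x)) := by rw [cosetInclusion_cosetComul]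

/-- The action of `G` on the quotient space `K \ G` given by the coproduct. -/
def quotientAction : Action G K.rightCoset where
  δ := K.cosetComul
  coassoc x := map_id_injective (f := K.rightCoset.subtype) Subtype.val_injective <| by
    rw [map_subtype_assoc_map_cosetComul, G.coassoc, map_map]
    exact (K.map_subtype_cosetComul G.Δ x).symm

theorem quotientAction_isQuotientAction : K.IsQuotientAction K.quotientAction :=
  K.cosetInclusion_cosetComul

end QuotientAction

/-- The quantum subgroup `A / I` defined by a closed `*`-ideal `I` to which the coproduct
descends. -/
def ofIdeal (I : Ideal A) [I.IsTwoSided] [IsStarIdeal I] [IsClosed (I : Set A)]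
    (hI : ∀ a ∈ I, map (quotientMk I) (quotientMk I) (G.Δ a) = 0) : QuantumSubgroup G where
  carrier := A ⧸ I
  Δ' := quotientLift I ((map (quotientMk I) (quotientMk I)).comp G.Δ) hI
  π := quotientMk I
  surjective := quotientMk_surjective I
  compat a := (quotientLift_mk I ((map (quotientMk I) (quotientMk I)).comp G.Δ) hI a).symm

variable {C : Type u} [CStarAlgebra C] {α : Action G C} {χ : C →⋆ₐ[ℂ] ℂ}

/-- The quantum subgroup `K` fixes the character `χ`: restricted to `K`, the orbit map of `χ` is
constant. -/
def Fixes (K : QuantumSubgroup G) (α : Action G C) (χ : C →⋆ₐ[ℂ] ℂ) : Prop :=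
  ∀ c, K.π (α.orbitMap χ c) = χ c • (1 : K.carrier)

theorem IsStabilizer.fixes {K : QuantumSubgroup G} (hK : K.IsStabilizer α χ) : K.Fixes α χ :=
  fun c => by
    rw [← sub_eq_zero, ← map_one K.π, ← map_smul, ← map_sub, hK]
    exact subset_closure (TwoSidedIdeal.subset_span ⟨c, rfl⟩)

end QuantumSubgroup

namespace Action

open SpatialTensor QuantumSubgroup

variable {A C : Type u} [CStarAlgebra A] [CStarAlgebra C] {G : CompactQuantumGroup A}
  (α : Action G C)

section OrbitMap

variable (χ : C →⋆ₐ[ℂ] ℂ)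

theorem orbitMap_apply (c : C) : α.orbitMap χ c = leftSlice (charFunctional χ) (α.δ c) := rfl

theorem comul_orbitMap (c : C) :
    G.Δ (α.orbitMap χ c) = map (α.orbitMap χ) (StarAlgHom.id ℂ A) (α.δ c) :=
  calc G.Δ (α.orbitMap χ c)
    _ = charSlice χ (map (StarAlgHom.id ℂ C) G.Δ (α.δ c)) :=
      (leftSlice_map (charFunctional χ) (StarAlgHom.id ℂ C) G.Δ (α.δ c)).symm
    _ = map (charSlice χ) (StarAlgHom.id ℂ A) (map α.δ (StarAlgHom.id ℂ A) (α.δ c)) := by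
      rw [← α.coassoc, charSlice_assoc]
    _ = map (α.orbitMap χ) (StarAlgHom.id ℂ A) (α.δ c) := map_map _ _ _ _ _

variable {α χ}

theorem map_comul_orbitMap {B D : Type u} [CStarAlgebra B] [CStarAlgebra D] {π : A →⋆ₐ[ℂ] B}
    (hπ : ∀ c, π (α.orbitMap χ c) = χ c • (1 : B)) (σ : A →⋆ₐ[ℂ] D) (c : C) :
    map π σ (G.Δ (α.orbitMap χ c)) = tmul 1 (σ (α.orbitMap χ c)) := by
  have hhom : map (π.comp (α.orbitMap χ)) σ = (inclRight B D).comp (σ.comp (charSlice χ)) :=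
    hom_ext fun x a => by
      change map (π.comp (α.orbitMap χ)) σ (tmul x a) = tmul 1 (σ (charSlice χ (tmul x a)))
      rw [map_tmul, charSlice_tmul, map_smul, tmul_smul, ← smul_tmul, StarAlgHom.comp_apply, hπ]
  rw [α.comul_orbitMap, map_map]
  exact DFunLike.congr_fun hhom (α.δ c)

theorem orbitMap_mem_rightCoset {K : QuantumSubgroup G} (hK : K.Fixes α χ) (c : C) :
    α.orbitMap χ c ∈ K.rightCoset :=
  map_comul_orbitMap hK (StarAlgHom.id ℂ A) c

end OrbitMap

section Stabilizer

variable (χ : C →⋆ₐ[ℂ] ℂ)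

/-- The ideal generated algebraically by the elements `T_χ(c) - χ(c) 1`, whose closure is
`stabilizerIdeal`. It is stored as a left ideal, since these have closures and quotients. -/
def algStabilizerIdeal : Ideal A :=
  TwoSidedIdeal.asIdeal (TwoSidedIdeal.span {a | ∃ c, a = α.orbitMap χ c - χ c • (1 : A)})

instance : (α.algStabilizerIdeal χ).IsTwoSided :=
  inferInstanceAs (TwoSidedIdeal.asIdeal _).IsTwoSided

instance : IsStarIdeal (α.algStabilizerIdeal χ) where
  star_mem _ ha := star_mem_span (by
    rintro _ ⟨c, rfl⟩
    exact ⟨star c, by rw [star_sub, star_smul, star_one, map_star, map_star]⟩) ha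

variable {α χ}

theorem eq_zero_of_mem_stabilizerIdeal {B : Type u} [CStarAlgebra B] {f : A →⋆ₐ[ℂ] B}
    (hf : ∀ c, f (α.orbitMap χ c) = χ c • (1 : B)) {a : A} (ha : a ∈ α.stabilizerIdeal χ) :
    f a = 0 := by
  refine closure_minimal (t := {a | f a = 0}) (fun x hx => ?_)
    (isClosed_eq (continuous_hom f) continuous_const) ha
  refine (TwoSidedIdeal.mem_ker f).mp ((TwoSidedIdeal.span_le (I := TwoSidedIdeal.ker f)).mpr ?_ hx)
  rintro _ ⟨c, rfl⟩
  exact (TwoSidedIdeal.mem_ker f).mpr (by rw [map_sub, hf, map_smul, map_one, sub_self])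

variable (α χ)

theorem quotientMk_orbitMap (c : C) :
    quotientMk (α.algStabilizerIdeal χ).closure (α.orbitMap χ c) = χ c • 1 := by
  rw [← sub_eq_zero, ← map_one (quotientMk _), ← map_smul, ← map_sub, quotientMk_eq_zero]
  exact subset_closure (TwoSidedIdeal.subset_span ⟨c, rfl⟩)

theorem exists_isStabilizer : ∃ K : QuantumSubgroup G, K.IsStabilizer α χ := by
  let I := (α.algStabilizerIdeal χ).closure
  have hcomul (c : C) : (map (quotientMk I) (quotientMk I)).comp G.Δ (α.orbitMap χ c) =
      χ c • 1 := by
    rw [StarAlgHom.comp_apply, map_comul_orbitMap (α.quotientMk_orbitMap χ),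
      α.quotientMk_orbitMap χ, tmul_smul, one_eq_tmul]
  exact ⟨ofIdeal I fun a ha => eq_zero_of_mem_stabilizerIdeal hcomul ha,
    fun a => quotientMk_eq_zero I⟩

end Stabilizer

section Ergodic

variable {α} {h : PosFunctional A}

theorem δ_rightSlice (hinv : ∀ a, rightSlice h (G.Δ a) = h a • (1 : A)) (c : C) :
    α.δ (rightSlice h (α.δ c)) = tmul (rightSlice h (α.δ c)) 1 :=
  ext_leftSlice fun φ => by
    calc leftSlice φ (α.δ (rightSlice h (α.δ c)))
      _ = leftSlice φ (rightSlice h (map α.δ (StarAlgHom.id ℂ A) (α.δ c))) := by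
        rw [rightSlice_map]
        rfl
      _ = rightSlice h (G.Δ (leftSlice φ (α.δ c))) := by
        rw [leftSlice_rightSlice, α.coassoc, leftSlice_map]
        rfl
      _ = leftSlice φ (tmul (rightSlice h (α.δ c)) 1) := by
        rw [hinv, apply_leftSlice_eq_apply_rightSlice, leftSlice_tmul]

theorem rightSlice_eq_smul_one (hinv : ∀ a, rightSlice h (G.Δ a) = h a • (1 : A))
    (herg : α.IsErgodic) (χ : C →⋆ₐ[ℂ] ℂ) (c : C) :
    rightSlice h (α.δ c) = h (α.orbitMap χ c) • (1 : C) := by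
  obtain ⟨z, hz⟩ := herg _ (δ_rightSlice hinv c)
  have hscalar : h (α.orbitMap χ c) = z := by
    rw [orbitMap_apply, apply_leftSlice_eq_apply_rightSlice, hz]
    change χ (z • 1) = z
    rw [map_smul, map_one, smul_eq_mul, mul_one]
  rw [hscalar, hz]

theorem orbitMap_injective (hfaithful : h.IsFaithful)
    (hinv : ∀ a, rightSlice h (G.Δ a) = h a • (1 : A)) (herg : α.IsErgodic)
    (hinj : Function.Injective α.δ) (χ : C →⋆ₐ[ℂ] ℂ) : Function.Injective (α.orbitMap χ) := by
  refine (injective_iff_map_eq_zero _).mpr fun c hc => ?_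
  refine (injective_iff_map_eq_zero α.δ).mp hinj c ?_
  refine eq_zero_of_rightSlice_star_mul_self hfaithful ?_
  rw [← map_star, ← map_mul, rightSlice_eq_smul_one hinv herg χ, map_mul, hc, mul_zero, map_zero,
    zero_smul]

end Ergodic

end Action

end CQG

end

theorem mainTheorem1_general {A C : Type u} [CStarAlgebra A] [CStarAlgebra C]
    (G : CQG.CompactQuantumGroup A) (h : CQG.PosFunctional A) (hHaar : G.IsHaarState h)
    (hfaithful : h.IsFaithful) (α : CQG.Action G C) (hergodic : α.IsErgodic)
    (hinj : Function.Injective α.δ) (χ : C →⋆ₐ[ℂ] ℂ) :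
    (∃ K : CQG.QuantumSubgroup G, K.IsStabilizer α χ) ∧
    ∀ K : CQG.QuantumSubgroup G, K.Fixes α χ →
      ∃ (T : C →⋆ₐ[ℂ] K.rightCoset) (η : CQG.Action G K.rightCoset),
        (∀ c, (T c : A) = α.orbitMap χ c) ∧
        K.IsQuotientAction η ∧
        (∀ c, η.δ (T c) = CQG.SpatialTensor.map T (StarAlgHom.id ℂ A) (α.δ c)) ∧
        Function.Injective T := by
  refine ⟨α.exists_isStabilizer χ, fun K hK => ?_⟩
  let T : C →⋆ₐ[ℂ] K.rightCoset :=
    (α.orbitMap χ).codRestrict K.rightCoset (CQG.Action.orbitMap_mem_rightCoset hK)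
  have hT : K.rightCoset.subtype.comp T = α.orbitMap χ := rfl
  have hequivariant (c : C) :
      K.quotientAction.δ (T c) = CQG.SpatialTensor.map T (StarAlgHom.id ℂ A) (α.δ c) := by
    refine K.cosetInclusion_injective ((K.cosetInclusion_cosetComul (T c)).trans ?_)
    rw [CQG.QuantumSubgroup.cosetInclusion, CQG.SpatialTensor.map_map, hT]
    exact α.comul_orbitMap χ c
  have hT_injective : Function.Injective T := fun c c' hcc' =>
    CQG.Action.orbitMap_injective hfaithful hHaar.right_inv hergodic hinj χ
      (congrArg Subtype.val hcc')
  exact ⟨T, K.quotientAction, fun _ => rfl, K.quotientAction_isQuotientAction, hequivariant,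
    hT_injective⟩

theorem mainTheorem1 {A C : Type u} [CStarAlgebra A] [CStarAlgebra C]
    (G : CQG.CompactQuantumGroup A) (h : CQG.PosFunctional A) (hHaar : G.IsHaarState h)
    (hfaithful : h.IsFaithful)
    (α : CQG.Action G C) (hnondeg : α.IsNondegenerate) (hergodic : α.IsErgodic)
    (hinj : Function.Injective α.δ) (χ : C →⋆ₐ[ℂ] ℂ) :
    (∃ K : CQG.QuantumSubgroup G, K.IsStabilizer α χ) ∧
    ∀ K : CQG.QuantumSubgroup G, K.IsStabilizer α χ →
      ∃ (T : C →⋆ₐ[ℂ] K.rightCoset) (η : CQG.Action G K.rightCoset),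
        (∀ c, (T c : A) = α.orbitMap χ c) ∧
        K.IsQuotientAction η ∧
        (∀ c, η.δ (T c) = CQG.SpatialTensor.map T (StarAlgHom.id ℂ A) (α.δ c)) ∧
        Function.Injective T :=
  have hgeneral := mainTheorem1_general G h hHaar hfaithful α hergodic hinj χ
  ⟨hgeneral.1, fun K hK => hgeneral.2 K hK.fixes⟩
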